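/- Let $N\ge 2$, $\gamma(\alpha)=\pi^{N/2}2^{\alpha}\Gamma(\alpha/2)/\Gamma((N-\alpha)/2)$ and $I_1f(x)=\gamma(1)^{-1}\int_{\mathbb R^N}f(y)|x-y|^{1-N}\,dy$. Let $\mathcal H^1(\mathbb R^N)$ be the space of $f\in L^1(\mathbb R^N)$ whose Riesz transform $Rf=\nabla(I_1f)$ (distributional gradient) is in $L^1$, with the Stein–Weiss norm $$\|f\|_{\mathcal H^1}=\int_{\mathbb R^N}|(f(x),Rf(x))|\,dx .$$ For real-valued $u$ put $$|u|_{BMO}=\sup\Big\{\int_{\mathbb R^N}uf \;:\; f\in\mathcal H^1(\mathbb R^N),\ \|f\|_{\mathcal H^1}\le 1\Big\}\in[0,\infty],$$ where, as usual, $\int uf$ is the ordinary integral when $f\in\mathcal H^1$ is bounded with compact support, and for general $f\in\mathcal H^1$ denotes the continuous extension: a limit of $\int uf_n$ along bounded compactly supported $f_n\in\mathcal H^1$ with $f_n\to f$ in $\mathcal H^1$ (the supremum is taken over all such limits). Let $u:\mathbb R^N\to\mathbb R$ be measurable with $\int_{\mathbb R^N}|u(x)|(1+|x|)^{-N-1}\,dx<\infty$,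 and suppose that $(-\Delta)^{N/2}u$ is a finite signed Radon measure $\mu$, that is, $\int_{\mathbb R^N} u\,(-\Delta)^{N/2}\varphi\,dx=\int_{\mathbb R^N}\varphi\,d\mu$ for every Schwartz function $\varphi$, where $(-\Delta)^{N/2}\varphi$ has Fourier transform $(2\pi|\xi|)^N\widehat\varphi(\xi)$ (with $\widehat\varphi(\xi)=\int\varphi(x)e^{-2\pi i x\cdot\xi}\,dx$). Then $u$ has bounded mean oscillation and $$|u|_{BMO}\le c_0\,|\mu|(\mathbb R^N),\qquad c_0=\frac{1}{(N-1)\,\gamma(N-1)} .$$ -/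

import Mathlib

namespace RieszBMO

open MeasureTheory Filter Topology
open scoped ENNReal ContDiff

noncomputable section

/-- Euclidean space `ℝ^N`. -/
abbrev E (N : ℕ) : Type := EuclideanSpace ℝ (Fin N)

/-- The normalization constant of the Riesz potential of order `α` on `ℝ^N`:
`γ(α) = π^(N/2) 2^α Γ(α/2) / Γ((N-α)/2)`. -/
def gammaConst (N : ℕ) (α : ℝ) : ℝ :=
  Real.pi ^ ((N : ℝ) / 2) * 2 ^ α * Real.Gamma (α / 2) / Real.Gamma (((N : ℝ) - α) / 2)

/-- The Riesz potential `I_α g (x) = γ(α)⁻¹ ∫ g(y) / |x - y|^(N-α) dy`. -/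
def rieszPotential {N : ℕ} (α : ℝ) (g : E N → ℝ) (x : E N) : ℝ :=
  1 / gammaConst N α * ∫ y, g y / ‖x - y‖ ^ ((N : ℝ) - α)

/-- `g` is the gradient of `w` in the sense of distributions, both being locally integrable. -/
def HasWeakGradient {N : ℕ} (w : E N → ℝ) (g : E N → E N) : Prop :=
  LocallyIntegrable w ∧ LocallyIntegrable g ∧
    ∀ φ : E N → ℝ, ContDiff ℝ ∞ φ → HasCompactSupport φ →
      ∫ x, w x • gradient φ x = - ∫ x, φ x • g x

/-- The vector Riesz transform `R f = ∇ (I₁ f)`: the distributional gradient of `I₁ f`, whenever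
that distribution is a locally integrable vector field (which is then unique almost everywhere;
a representative is chosen). -/
def rieszTransform {N : ℕ} (f : E N → ℝ) : E N → E N :=
  Classical.epsilon fun g => HasWeakGradient (rieszPotential 1 f) g

/-- Membership in the Hardy space `H¹(ℝ^N)` of Stein and Weiss: `f` and `R f` are integrable. -/
def MemH1 {N : ℕ} (f : E N → ℝ) : Prop :=
  Integrable f ∧ HasWeakGradient (rieszPotential 1 f) (rieszTransform f) ∧
    Integrable (rieszTransform f)

/-- The Stein–Weiss norm `∫ |(f, R f)|`, with the Euclidean norm of the vector
`(f(x), R f(x)) ∈ ℝ^(N+1)`. -/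
def h1Norm {N : ℕ} (f : E N → ℝ) : ℝ :=
  ∫ x, Real.sqrt (f x ^ 2 + ‖rieszTransform f x‖ ^ 2)

/-- `ℓ` is the value at `f ∈ H¹` of the linear functional on `H¹` induced by `u`, "`∫ u f`".
For `u ∈ BMO` and general `f ∈ H¹` the product `u f` need not be integrable; as usual, the
functional is the integral on the dense subspace of bounded compactly supported elements of `H¹`,
and is extended to `H¹` by continuity. -/
def IsDualPairing {N : ℕ} (u f : E N → ℝ) (ℓ : ℝ) : Prop :=
  ∃ F : ℕ → E N → ℝ,
    (∀ n, MemH1 (F n) ∧ MemLp (F n) ∞ ∧ HasCompactSupport (F n)) ∧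
    Tendsto (fun n => h1Norm (fun x => f x - F n x)) atTop (𝓝 0) ∧
    Tendsto (fun n => ∫ x, u x * F n x) atTop (𝓝 ℓ)

/-- The `BMO` seminorm dual to the Stein–Weiss norm, with values in `[0, ∞]`:
the supremum of "`∫ u f`" over all `f ∈ H¹` with norm at most one. -/
def bmoSeminorm {N : ℕ} (u : E N → ℝ) : ℝ≥0∞ :=
  ⨆ (f : E N → ℝ) (ℓ : ℝ) (_ : MemH1 f) (_ : h1Norm f ≤ 1) (_ : IsDualPairing u f ℓ),
    ENNReal.ofReal ℓ

/-- Bounded mean oscillation. -/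
def MemBMO {N : ℕ} (u : E N → ℝ) : Prop :=
  LocallyIntegrable u ∧ ∃ C : ℝ, ∀ (x : E N) (r : ℝ), 0 < r →
    ⨍ y in Metric.ball x r, |u y - ⨍ z in Metric.ball x r, u z| ≤ C

/-- The fractional Laplacian `(-Δ)^(α/2) φ` of a Schwartz function: the function with Fourier
transform `(2π|ξ|)^α φ̂(ξ)`. -/
def fracLaplacian {N : ℕ} (α : ℝ) (φ : SchwartzMap (E N) ℂ) : E N → ℂ :=
  FourierTransformInv.fourierInv
    fun ξ : E N => (((2 * Real.pi * ‖ξ‖) ^ α : ℝ) : ℂ) * FourierTransform.fourier (φ : E N → ℂ) ξ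

/-- The integral of a function against a finite signed measure. -/
def signedIntegral {N : ℕ} (μ : SignedMeasure (E N)) (φ : E N → ℂ) : ℂ :=
  (∫ x, φ x ∂μ.toJordanDecomposition.posPart) - ∫ x, φ x ∂μ.toJordanDecomposition.negPart

/-- `(-Δ)^(α/2) u = μ` in the sense of tempered distributions. -/
def HasFracLaplacian {N : ℕ} (α : ℝ) (u : E N → ℝ) (μ : SignedMeasure (E N)) : Prop :=
  ∀ φ : SchwartzMap (E N) ℂ,
    ∫ x, (u x : ℂ) * fracLaplacian α φ x = signedIntegral μ φ

end

end RieszBMO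

namespace RieszBMO

open MeasureTheory Filter Topology
open scoped ENNReal ContDiff FourierTransform RealInnerProductSpace

/-! Formally put φ = (-Δ)^(-N/2) f. Then ∫ u f = ∫ φ dμ, and everything reduces to a sup bound for
φ. The fundamental solution of (-Δ)^(N/2) is logarithmic, hence unbounded, but for f in H¹ a Riesz
transform can be traded against it. Since R has symbol iξ/|ξ|, f is minus the sum of the Riesz
transforms of the components of Rf, so φ is Rf convolved with a kernel homogeneous of degree zero:
φ(x) = -c₀ ∫ ⟪Rf(y), y - x⟫ / |y - x| dy. Hence |φ| ≤ c₀ ∫ |Rf| ≤ c₀ ‖f‖ in H¹. The kernel is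
computed in `integral_mul_inner_div_norm`, the constant in `gammaConst_sub_one`, and the symbol of
the distributional gradient of I₁f in `fourier_weakGradient_rieszPotential`.

As φ need not be a Schwartz function, f is first restricted to a frequency annulus (`bandPass`). Its
potential is then Schwartz and the equation for u applies to it exactly. The limit rests on two
facts: band-passed mean-zero functions converge in L¹ (`tendsto_integral_norm_bandPass_sub`), used
for f and for Rf, and for bounded compactly supported f they are dominated by a multiple of (1 +
|x|)^(-N-1), the weight attached to u (`exists_norm_bandPass_le`). Both enter through
`abs_integral_mul_le_of_potential_le`. General f in H¹ are reached by the limits in the definition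
of the pairing.

For bounded mean oscillation, u is tested on a ball against the sign of its oscillation, corrected
to have mean zero. The potential of such a function is bounded without its Riesz transform:
(-Δ)^(-N/2) is a superposition of heat evolutions, split at time r². Short times use boundedness,
long times use cancellation (`exists_norm_fourierInv_potentialSymbol_le`). -/

/-! ### Homogeneous kernels as superpositions of Gaussians -/

/-- Fubini for a superposition of nonnegative profiles `e t` with total mass `κ`. -/
lemma integral_superposition {X : Type*} [MeasurableSpace X] {μ : Measure X} [SFinite μ]
    {A : X → ℂ} {e : ℝ → X → ℝ} {κ : X → ℝ} (hA : AEStronglyMeasurable A μ)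
    (he : Measurable (Function.uncurry e)) (h0 : ∀ t > 0, ∀ y, 0 ≤ e t y)
    (hκ : ∀ᵐ y ∂μ, IntegrableOn (fun t => e t y) (Set.Ioi 0) ∧ ∫ t in Set.Ioi 0, e t y = κ y)
    (hint : Integrable (fun y => A y * κ y) μ) :
    ∫ t in Set.Ioi (0 : ℝ), ∫ y, A y * e t y ∂μ = ∫ y, A y * κ y ∂μ := by
  have hprod : Integrable (Function.uncurry fun (t : ℝ) (y : X) => A y * (e t y : ℂ))
      ((volume.restrict (Set.Ioi (0 : ℝ))).prod μ) := by
    rw [integrable_prod_iff']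
    · constructor
      · filter_upwards [hκ] with y hy
        exact (hy.1.ofReal).const_mul (A y)
      · refine hint.norm.congr ?_
        filter_upwards [hκ] with y hy
        simp only [Function.uncurry_apply_pair, norm_mul, Complex.norm_real]
        rw [integral_const_mul, ← hy.2]
        congr 1
        rw [Real.norm_of_nonneg (setIntegral_nonneg measurableSet_Ioi fun t ht => h0 t ht y)]
        refine setIntegral_congr_fun measurableSet_Ioi fun t ht => ?_
        exact (Real.norm_of_nonneg (h0 t ht y)).symm
    · exact hA.comp_snd.mul (Complex.measurable_ofReal.comp he).aestronglyMeasurable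
  rw [integral_integral_swap hprod]
  refine integral_congr_ae ?_
  filter_upwards [hκ] with y hy
  rw [integral_const_mul, integral_complex_ofReal, hy.2]

lemma integral_rpow_mul_exp_neg_mul {s a : ℝ} (hs : 0 < s) (ha : 0 < a) :
    IntegrableOn (fun t : ℝ => t ^ (s - 1) * Real.exp (-(a * t))) (Set.Ioi 0) ∧
      ∫ t in Set.Ioi (0 : ℝ), t ^ (s - 1) * Real.exp (-(a * t)) = (1 / a) ^ s * Real.Gamma s := by
  have h := Real.integral_rpow_mul_exp_neg_mul_Ioi hs ha
  refine ⟨?_, h⟩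
  -- A non-integrable function has integral zero by convention, whereas the Gamma value is positive.
  by_contra hn
  rw [integral_undef hn] at h
  exact (mul_pos (Real.rpow_pos_of_pos (by positivity) s) (Real.Gamma_pos_of_pos hs)).ne h

lemma integral_rpow_mul_exp_neg_div {s a : ℝ} (hs : 0 < s) (ha : 0 < a) :
    IntegrableOn (fun t : ℝ => t ^ (-s - 1) * Real.exp (-(a / t))) (Set.Ioi 0) ∧
      ∫ t in Set.Ioi (0 : ℝ), t ^ (-s - 1) * Real.exp (-(a / t)) = (1 / a) ^ s * Real.Gamma s := by
  have h : ∫ t in Set.Ioi (0 : ℝ), t ^ (-s - 1) * Real.exp (-(a / t)) =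
      (1 / a) ^ s * Real.Gamma s := by
    -- Substitution of `t⁻¹` for `t`.
    rw [← (integral_rpow_mul_exp_neg_mul hs ha).2,
      ← integral_comp_rpow_Ioi (fun t : ℝ => t ^ (s - 1) * Real.exp (-(a * t)))
        (by norm_num : (-1 : ℝ) ≠ 0)]
    refine setIntegral_congr_fun measurableSet_Ioi fun t ht => ?_
    have ht : 0 < t := ht
    simp only [abs_neg, abs_one, one_mul, smul_eq_mul]
    rw [← mul_assoc, ← Real.rpow_mul ht.le, ← Real.rpow_add ht, Real.rpow_neg_one, div_eq_mul_inv]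
    congr 2
    ring
  refine ⟨?_, h⟩
  by_contra hn
  rw [integral_undef hn] at h
  exact (mul_pos (Real.rpow_pos_of_pos (by positivity) s) (Real.Gamma_pos_of_pos hs)).ne h

variable {N : ℕ}

/-- The Gaussian of frequency width `t`, modulated so that its Fourier transform is centred
at `x`. -/
noncomputable def modGauss (t : ℝ) (x ξ : E N) : ℂ :=
  Complex.exp (-(Real.pi / t : ℝ) * (‖ξ‖ : ℂ) ^ 2 + 2 * Real.pi * Complex.I * (⟪x, ξ⟫ : ℝ))

lemma modGauss_eq (t : ℝ) (x ξ : E N) :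
    modGauss t x ξ = Complex.exp (2 * Real.pi * Complex.I * (⟪x, ξ⟫ : ℝ)) *
      (Real.exp (-(Real.pi * ‖ξ‖ ^ 2 / t)) : ℝ) := by
  rw [modGauss, Complex.ofReal_exp, ← Complex.exp_add]
  congr 1
  push_cast
  ring

lemma integrable_modGauss {t : ℝ} (ht : 0 < t) (x : E N) : Integrable (modGauss t x) := by
  have : 0 < ((Real.pi / t : ℝ) : ℂ).re := by
    rw [Complex.ofReal_re]; exact div_pos Real.pi_pos ht
  exact GaussianFourier.integrable_cexp_neg_mul_sq_norm_add this _ x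

lemma fourier_modGauss {t : ℝ} (ht : 0 < t) (x w : E N) :
    𝓕 (modGauss t x) w =
      (t ^ ((N : ℝ) / 2) * Real.exp (-(Real.pi * ‖x - w‖ ^ 2 * t)) : ℝ) := by
  have : 0 < ((Real.pi / t : ℝ) : ℂ).re := by
    rw [Complex.ofReal_re]; exact div_pos Real.pi_pos ht
  have h := fourier_gaussian_innerProductSpace' this x w
  have h2 : (Real.pi / ((Real.pi / t : ℝ) : ℂ)) = (t : ℂ) := by
    push_cast
    have : (Real.pi : ℂ) ≠ 0 := by exact_mod_cast Real.pi_ne_zero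
    have : (t : ℂ) ≠ 0 := by exact_mod_cast ht.ne'
    field_simp
  rw [h2] at h
  unfold modGauss
  refine h.trans ?_
  rw [finrank_euclideanSpace_fin, Complex.ofReal_mul, Complex.ofReal_cpow ht.le,
    Complex.ofReal_exp]
  congr 2
  · push_cast; rfl
  · push_cast
    have : (Real.pi : ℂ) ≠ 0 := by exact_mod_cast Real.pi_ne_zero
    have : (t : ℂ) ≠ 0 := by exact_mod_cast ht.ne'
    field_simp

lemma integral_fourier_mul {f g : E N → ℂ} (hf : Integrable f) (hg : Integrable g) :
    ∫ ξ, 𝓕 f ξ * g ξ = ∫ x, f x * 𝓕 g x := by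
  have h := VectorFourier.integral_fourierIntegral_smul_eq_flip (L := innerₗ (E N))
    Real.continuous_fourierChar continuous_inner hf hg
  rw [flip_innerₗ] at h
  exact h

lemma integral_fourier_mul_modGauss {t : ℝ} (ht : 0 < t) {h : E N → ℂ} (hh : Integrable h)
    (x : E N) :
    ∫ ξ, 𝓕 h ξ * modGauss t x ξ =
      (t ^ ((N : ℝ) / 2) : ℝ) * ∫ y, h y * (Real.exp (-(Real.pi * ‖x - y‖ ^ 2 * t)) : ℝ) := by
  rw [integral_fourier_mul hh (integrable_modGauss ht x), ← integral_const_mul]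
  refine integral_congr_ae (ae_of_all _ fun y => ?_)
  simp only [fourier_modGauss ht]
  push_cast
  ring

lemma norm_modGauss (t : ℝ) (x ξ : E N) :
    ‖modGauss t x ξ‖ = Real.exp (-(Real.pi * ‖ξ‖ ^ 2 / t)) := by
  rw [modGauss_eq, norm_mul, Complex.norm_real, Real.norm_of_nonneg (Real.exp_nonneg _),
    mul_right_comm, ← Complex.ofReal_ofNat, ← Complex.ofReal_mul, ← Complex.ofReal_mul,
    Complex.norm_exp_ofReal_mul_I, one_mul]

lemma integrable_norm_mul_modGauss {t : ℝ} (ht : 0 < t) (x : E N) :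
    Integrable (fun ξ => ‖ξ‖ * ‖modGauss t x ξ‖) := by
  have hpos : 0 < Real.pi / (2 * t) := div_pos Real.pi_pos (by positivity)
  refine ((integrable_modGauss (by positivity : 0 < 2 * t) x).norm.const_mul
    (1 / √(Real.pi / (2 * t)))).mono'
    (continuous_norm.aestronglyMeasurable.mul (integrable_modGauss ht x).1.norm)
    (ae_of_all _ fun ξ => ?_)
  rw [norm_mul, norm_norm, norm_norm, norm_modGauss, norm_modGauss]
  have hs : 0 < √(Real.pi / (2 * t)) := Real.sqrt_pos.2 hpos
  -- Half of the Gaussian exponent is spent on the factor `‖ξ‖`, through `y ≤ exp (y ^ 2)`; the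
  -- other half is the Gaussian of parameter `2 * t`.
  set y := √(Real.pi / (2 * t)) * ‖ξ‖ with hy
  have hy2 : y ^ 2 = Real.pi * ‖ξ‖ ^ 2 / (2 * t) := by
    rw [hy, mul_pow, Real.sq_sqrt hpos.le]; ring
  have h1 : y ≤ Real.exp (y ^ 2) := by
    nlinarith [Real.add_one_le_exp (y ^ 2), sq_nonneg (y - 1)]
  have h2 : ‖ξ‖ = 1 / √(Real.pi / (2 * t)) * y := by rw [hy]; field_simp
  have h3 : -(Real.pi * ‖ξ‖ ^ 2 / t) = -(y ^ 2) - y ^ 2 := by rw [hy2]; field_simp; ring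
  rw [h3, ← hy2, h2, mul_assoc, Real.exp_sub]
  gcongr
  rw [mul_div_assoc', div_le_iff₀ (Real.exp_pos _), mul_comm]
  gcongr

/-- Multiplication by `⟪v, ξ⟫` corresponds to differentiation along `v` on the other side, so the
closed form in `fourier_modGauss` is differentiated in `w`. -/
lemma fourier_inner_mul_modGauss {t : ℝ} (ht : 0 < t) (v x w : E N) :
    𝓕 (fun ξ => Complex.I * (⟪v, ξ⟫ : ℝ) * modGauss t x ξ) w =
      (t ^ ((N : ℝ) / 2) * t * (⟪v, w - x⟫ * Real.exp (-(Real.pi * ‖x - w‖ ^ 2 * t))) : ℝ) := by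
  have hi := integrable_modGauss ht x
  have hn := integrable_norm_mul_modGauss ht x
  have h1 := congrFun (Real.fderiv_fourier hi hn) w
  have hint : Integrable (VectorFourier.fourierSMulRight (innerSL ℝ) (modGauss t x)) := by
    refine (hn.const_mul (2 * Real.pi * ‖(innerSL ℝ : E N →L[ℝ] E N →L[ℝ] ℝ)‖)).mono' ?_
      (ae_of_all _ fun ξ => ?_)
    · exact hi.1.fourierSMulRight
    · refine (VectorFourier.norm_fourierSMulRight_le _ _ _).trans_eq ?_
      ring
  have h2 := congrArg (fun L => L v) h1
  rw [Real.fourier_continuousLinearMap_apply hint] at h2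
  have h3 : HasFDerivAt (𝓕 (modGauss t x))
      (Complex.ofRealCLM ∘L ((t ^ ((N : ℝ) / 2)) • Real.exp (-(Real.pi * ‖x - w‖ ^ 2 * t)) •
        (-((t * Real.pi) • (2 • (innerSL ℝ (x - w)).comp (-ContinuousLinearMap.id ℝ (E N))))))) w := by
    have : 𝓕 (modGauss t x) = fun w => Complex.ofRealCLM
      (t ^ ((N : ℝ) / 2) * Real.exp (-(Real.pi * ‖x - w‖ ^ 2 * t))) := by
      ext w; exact fourier_modGauss ht x w
    rw [this]
    refine Complex.ofRealCLM.hasFDerivAt.comp w (HasFDerivAt.const_mul (HasFDerivAt.exp ?_) _)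
    refine HasFDerivAt.neg ?_
    have := ((hasFDerivAt_id w).const_sub x).norm_sq.const_mul (t * Real.pi)
    refine (this.congr_of_eventuallyEq (Eventually.of_forall fun y => ?_))
    simp only [id]
    ring
  rw [h3.fderiv] at h2
  have h4 : 𝓕 (fun ξ => Complex.I * (⟪v, ξ⟫ : ℝ) * modGauss t x ξ) w =
      (-(1 / (2 * Real.pi : ℝ)) : ℂ) *
        𝓕 (fun ξ => VectorFourier.fourierSMulRight (innerSL ℝ) (modGauss t x) ξ v) w := by
    rw [Real.fourier_eq, Real.fourier_eq, ← integral_const_mul]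
    refine integral_congr_ae (ae_of_all _ fun ξ => ?_)
    have : (Real.pi : ℂ) ≠ 0 := by exact_mod_cast Real.pi_ne_zero
    simp only [VectorFourier.fourierSMulRight_apply, Circle.smul_def, smul_eq_mul,
      Complex.real_smul]
    rw [show (innerSL ℝ) ξ v = ⟪v, ξ⟫ from real_inner_comm v ξ]
    push_cast
    field_simp
  rw [h4, ← h2]
  have : (Real.pi : ℂ) ≠ 0 := by exact_mod_cast Real.pi_ne_zero
  simp [-Complex.ofReal_exp]
  field_simp
  rw [inner_sub_right, real_inner_comm, real_inner_comm x v]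
  push_cast
  rfl

lemma integral_fourier_mul_inner_modGauss {t : ℝ} (ht : 0 < t) {h : E N → ℂ} (hh : Integrable h)
    (v x : E N) :
    ∫ ξ, 𝓕 h ξ * (Complex.I * (⟪v, ξ⟫ : ℝ) * modGauss t x ξ) =
      (t ^ ((N : ℝ) / 2) * t : ℝ) *
        ∫ y, h y * (⟪v, y - x⟫ : ℝ) * (Real.exp (-(Real.pi * ‖x - y‖ ^ 2 * t)) : ℝ) := by
  have hi : Integrable (fun ξ => Complex.I * (⟪v, ξ⟫ : ℝ) * modGauss t x ξ) := by
    refine ((integrable_norm_mul_modGauss ht x).const_mul ‖v‖).mono' ?_ (ae_of_all _ fun ξ => ?_)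
    · exact (by fun_prop : Continuous fun ξ : E N => Complex.I * ((⟪v, ξ⟫ : ℝ) : ℂ)
        ).aestronglyMeasurable.mul (integrable_modGauss ht x).1
    · rw [norm_mul, norm_mul, Complex.norm_I, one_mul, Complex.norm_real, ← mul_assoc]
      gcongr
      exact norm_inner_le_norm v ξ
  rw [integral_fourier_mul hh hi, ← integral_const_mul]
  refine integral_congr_ae (ae_of_all _ fun y => ?_)
  simp only [fourier_inner_mul_modGauss ht]
  push_cast
  ring

lemma ae_ne (hN : 0 < N) (x : E N) : ∀ᵐ y : E N, y ≠ x := by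
  have : Nonempty (Fin N) := ⟨⟨0, hN⟩⟩
  rw [ae_iff]
  simp

lemma one_div_mul_sq_rpow {a : ℝ} (ha : 0 ≤ a) (s : ℝ) :
    (1 / (Real.pi * a ^ 2)) ^ s = Real.pi ^ (-s) * a ^ (-(2 * s)) := by
  rw [one_div, Real.inv_rpow (by positivity), Real.mul_rpow Real.pi_pos.le (by positivity),
    ← Real.rpow_natCast a 2, ← Real.rpow_mul ha, mul_inv, ← Real.rpow_neg Real.pi_pos.le,
    ← Real.rpow_neg ha]
  norm_num

lemma pi_rpow_neg_half_mul_Gamma : Real.pi ^ (-(1 / 2 : ℝ)) * Real.Gamma (1 / 2) = 1 := by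
  rw [Real.Gamma_one_half_eq, Real.sqrt_eq_rpow, ← Real.rpow_add Real.pi_pos]
  simp

lemma norm_expI (a : ℝ) : ‖Complex.exp (2 * Real.pi * Complex.I * a)‖ = 1 := by
  have : 2 * Real.pi * Complex.I * a = ((2 * Real.pi * a : ℝ) : ℂ) * Complex.I := by
    push_cast; ring
  rw [this, Complex.norm_exp_ofReal_mul_I]

/-- The bounded kernel `y ↦ ⟪v, y⟫ / ‖y‖` on the Fourier side. -/
lemma integral_mul_inner_div_norm (hN : 0 < N) {h : E N → ℂ} (hh : Integrable h)
    (hF : Integrable (fun ξ => 𝓕 h ξ * (‖ξ‖ ^ (-(N : ℝ)) : ℝ))) (v x : E N) :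
    ∫ y, h y * (⟪v, y - x⟫ / ‖x - y‖ : ℝ) =
      (Real.pi ^ (-(((N : ℝ) + 1) / 2)) * Real.Gamma (((N : ℝ) + 1) / 2) : ℝ) *
      ∫ ξ, 𝓕 h ξ * (Complex.I * (⟪v, ξ⟫ : ℝ) * Complex.exp (2 * Real.pi * Complex.I * (⟪x, ξ⟫ : ℝ)))
        * (‖ξ‖ ^ (-((N : ℝ) + 1)) : ℝ) := by
  have hFc : Continuous (𝓕 h) :=
    VectorFourier.fourierIntegral_continuous Real.continuous_fourierChar continuous_inner hh
  have hs : (0 : ℝ) < ((N : ℝ) + 1) / 2 := by positivity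
  set G := Real.Gamma (((N : ℝ) + 1) / 2) with hG
  -- Both `1 / ‖x - y‖` and `‖ξ‖ ^ (-(N + 1))` are integrals of Gaussians over `t`. For each `t` the
  -- two integrands agree by `integral_fourier_mul_inner_modGauss`, whose factor `t ^ (N / 2) * t`
  -- accounts for the different powers of `t` chosen in `left` and `right`.
  have left := integral_superposition (μ := (volume : Measure (E N)))
    (A := fun y => h y * (⟪v, y - x⟫ : ℝ))
    (e := fun t y => t ^ ((1 / 2 : ℝ) - 1) * Real.exp (-((Real.pi * ‖x - y‖ ^ 2) * t)))
    (κ := fun y => 1 / ‖x - y‖)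
    (hh.1.mul (by fun_prop : Continuous fun y : E N => ((⟪v, y - x⟫ : ℝ) : ℂ)).aestronglyMeasurable)
    (by fun_prop) (fun t ht y => by positivity)
    (by
      filter_upwards [ae_ne hN x] with y hy
      have hpos : 0 < ‖x - y‖ := norm_pos_iff.2 (sub_ne_zero.2 hy.symm)
      have := integral_rpow_mul_exp_neg_mul (s := 1 / 2) (a := Real.pi * ‖x - y‖ ^ 2) (by norm_num)
        (by positivity)
      refine ⟨this.1, this.2.trans ?_⟩
      rw [one_div_mul_sq_rpow hpos.le, mul_right_comm, pi_rpow_neg_half_mul_Gamma, one_mul]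
      norm_num [Real.rpow_neg_one])
    (by
      refine (hh.norm.const_mul ‖v‖).mono' ?_ (ae_of_all _ fun y => ?_)
      · exact (hh.1.mul (by fun_prop : Continuous fun y : E N =>
          ((⟪v, y - x⟫ : ℝ) : ℂ)).aestronglyMeasurable).mul
          (by fun_prop : Measurable fun y : E N => ((1 / ‖x - y‖ : ℝ) : ℂ)).aestronglyMeasurable
      · simp only [norm_mul, Complex.norm_real]
        have : ‖⟪v, y - x⟫‖ ≤ ‖v‖ * ‖x - y‖ := by
          rw [norm_sub_rev x y]; exact norm_inner_le_norm v (y - x)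
        calc ‖h y‖ * ‖⟪v, y - x⟫‖ * ‖1 / ‖x - y‖‖
            ≤ ‖h y‖ * (‖v‖ * ‖x - y‖) * ‖1 / ‖x - y‖‖ := by gcongr
          _ = ‖v‖ * ‖h y‖ * (‖x - y‖ * (1 / ‖x - y‖)) := by
              rw [Real.norm_of_nonneg (by positivity)]; ring
          _ ≤ ‖v‖ * ‖h y‖ * 1 := by
              gcongr; rw [mul_one_div]; exact div_self_le_one _
          _ = _ := mul_one _)
  have right := integral_superposition (μ := (volume : Measure (E N)))
    (A := fun ξ => 𝓕 h ξ *
      (Complex.I * (⟪v, ξ⟫ : ℝ) * Complex.exp (2 * Real.pi * Complex.I * (⟪x, ξ⟫ : ℝ))))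
    (e := fun t ξ => t ^ (-(((N : ℝ) + 1) / 2) - 1) * Real.exp (-((Real.pi * ‖ξ‖ ^ 2) / t)))
    (κ := fun ξ => Real.pi ^ (-(((N : ℝ) + 1) / 2)) * G * ‖ξ‖ ^ (-((N : ℝ) + 1)))
    (by fun_prop) (by fun_prop) (fun t ht y => by positivity)
    (by
      filter_upwards [ae_ne hN 0] with ξ hξ
      have hpos : 0 < ‖ξ‖ := norm_pos_iff.2 hξ
      have := integral_rpow_mul_exp_neg_div (a := Real.pi * ‖ξ‖ ^ 2) hs (by positivity)
      refine ⟨this.1, this.2.trans ?_⟩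
      rw [one_div_mul_sq_rpow hpos.le, mul_right_comm]
      congr 2
      ring)
    (by
      refine (hF.norm.const_mul (Real.pi ^ (-(((N : ℝ) + 1) / 2)) * G * ‖v‖)).mono' ?_ ?_
      · exact (by fun_prop : Measurable _).aestronglyMeasurable
      · filter_upwards [ae_ne hN 0] with ξ hξ
        have hpos : 0 < ‖ξ‖ := norm_pos_iff.2 hξ
        have hGpos : 0 < G := Real.Gamma_pos_of_pos hs
        simp only [norm_mul, Complex.norm_real, Complex.norm_I, norm_expI, one_mul, mul_one]
        rw [Real.norm_of_nonneg hGpos.le,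
          Real.norm_of_nonneg (Real.rpow_nonneg Real.pi_pos.le _),
          Real.norm_of_nonneg (Real.rpow_nonneg (norm_nonneg ξ) (-((N : ℝ) + 1))),
          Real.norm_of_nonneg (Real.rpow_nonneg (norm_nonneg ξ) (-(N : ℝ)))]
        have : ‖⟪v, ξ⟫‖ ≤ ‖v‖ * ‖ξ‖ := norm_inner_le_norm v ξ
        have e1 : ‖ξ‖ ^ (-(N : ℝ)) = ‖ξ‖ * ‖ξ‖ ^ (-((N : ℝ) + 1)) := by
          rw [← Real.rpow_one_add' hpos.le (by ring_nf; simp; omega)]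
          congr 1; ring
        rw [e1]
        calc _ ≤ ‖𝓕 h ξ‖ * (‖v‖ * ‖ξ‖) *
              (Real.pi ^ (-(((N : ℝ) + 1) / 2)) * G * ‖ξ‖ ^ (-((N : ℝ) + 1))) := by gcongr
          _ = _ := by ring)
  have mid : ∫ t in Set.Ioi (0 : ℝ), ∫ y, h y * (⟪v, y - x⟫ : ℝ) *
      ((t ^ ((1 / 2 : ℝ) - 1) * Real.exp (-((Real.pi * ‖x - y‖ ^ 2) * t)) : ℝ) : ℂ) =
      ∫ t in Set.Ioi (0 : ℝ), ∫ ξ, 𝓕 h ξ *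
      (Complex.I * (⟪v, ξ⟫ : ℝ) * Complex.exp (2 * Real.pi * Complex.I * (⟪x, ξ⟫ : ℝ))) *
      ((t ^ (-(((N : ℝ) + 1) / 2) - 1) * Real.exp (-((Real.pi * ‖ξ‖ ^ 2) / t)) : ℝ) : ℂ) := by
    refine setIntegral_congr_fun measurableSet_Ioi fun t ht => ?_
    have ht : 0 < t := ht
    have key := integral_fourier_mul_inner_modGauss ht hh v x
    have hc : t ^ (-(((N : ℝ) + 1) / 2) - 1) * (t ^ ((N : ℝ) / 2) * t) = t ^ ((1 / 2 : ℝ) - 1) := by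
      rw [← Real.rpow_add_one ht.ne', ← Real.rpow_add ht]
      congr 1; ring
    have e1 : ∫ y, h y * (⟪v, y - x⟫ : ℝ) *
        ((t ^ ((1 / 2 : ℝ) - 1) * Real.exp (-((Real.pi * ‖x - y‖ ^ 2) * t)) : ℝ) : ℂ) =
        ((t ^ ((1 / 2 : ℝ) - 1) : ℝ) : ℂ) *
        ∫ y, h y * (⟪v, y - x⟫ : ℝ) * (Real.exp (-(Real.pi * ‖x - y‖ ^ 2 * t)) : ℝ) := by
      rw [← integral_const_mul]
      refine integral_congr_ae (ae_of_all _ fun y => ?_)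
      simp only [Complex.ofReal_mul]; ring
    rw [e1, ← hc, Complex.ofReal_mul, mul_assoc, ← key, ← integral_const_mul]
    refine integral_congr_ae (ae_of_all _ fun y => ?_)
    simp only [Complex.ofReal_mul, modGauss_eq]; ring
  rw [left, right] at mid
  rw [← integral_const_mul]
  refine Eq.trans ?_ (mid.trans ?_)
  · refine integral_congr_ae (ae_of_all _ fun y => ?_)
    simp only [div_eq_mul_inv, Complex.ofReal_mul, one_mul]; ring
  · refine integral_congr_ae (ae_of_all _ fun y => ?_)
    simp only [Complex.ofReal_mul]; ring

/-- The Riesz kernel of order one on the Fourier side. -/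
lemma integral_mul_rieszKernel (hN : 2 ≤ N) {h : E N → ℂ} (hh : Integrable h) (x : E N)
    (hK : Integrable (fun y => h y * (1 / ‖x - y‖ ^ ((N : ℝ) - 1) : ℝ)))
    (hF : Integrable (fun ξ => 𝓕 h ξ * (1 / ‖ξ‖ : ℝ))) :
    (Real.pi ^ (-(((N : ℝ) - 1) / 2)) * Real.Gamma (((N : ℝ) - 1) / 2) : ℝ) *
      ∫ y, h y * (1 / ‖x - y‖ ^ ((N : ℝ) - 1) : ℝ) =
      ∫ ξ, 𝓕 h ξ * Complex.exp (2 * Real.pi * Complex.I * (⟪x, ξ⟫ : ℝ)) * (1 / ‖ξ‖ : ℝ) := by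
  have hFc : Continuous (𝓕 h) :=
    VectorFourier.fourierIntegral_continuous Real.continuous_fourierChar continuous_inner hh
  have hN' : (2 : ℝ) ≤ N := by exact_mod_cast hN
  have hs : (0 : ℝ) < ((N : ℝ) - 1) / 2 := by linarith
  set G := Real.Gamma (((N : ℝ) - 1) / 2) with hG
  have left := integral_superposition (μ := (volume : Measure (E N)))
    (A := h)
    (e := fun t y => t ^ (((N : ℝ) - 1) / 2 - 1) * Real.exp (-((Real.pi * ‖x - y‖ ^ 2) * t)))
    (κ := fun y => Real.pi ^ (-(((N : ℝ) - 1) / 2)) * G * (1 / ‖x - y‖ ^ ((N : ℝ) - 1)))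
    hh.1 (by fun_prop) (fun t ht y => by positivity)
    (by
      filter_upwards [ae_ne (by omega) x] with y hy
      have hpos : 0 < ‖x - y‖ := norm_pos_iff.2 (sub_ne_zero.2 hy.symm)
      have := integral_rpow_mul_exp_neg_mul (a := Real.pi * ‖x - y‖ ^ 2) hs (by positivity)
      refine ⟨this.1, this.2.trans ?_⟩
      rw [one_div_mul_sq_rpow hpos.le, mul_right_comm, Real.rpow_neg hpos.le, one_div]
      congr 4
      ring)
    (by
      refine (hK.const_mul (Real.pi ^ (-(((N : ℝ) - 1) / 2)) * G : ℝ)).congr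
        (ae_of_all _ fun y => ?_)
      simp only [Complex.ofReal_mul]; ring)
  have right := integral_superposition (μ := (volume : Measure (E N)))
    (A := fun ξ => 𝓕 h ξ * Complex.exp (2 * Real.pi * Complex.I * (⟪x, ξ⟫ : ℝ)))
    (e := fun t ξ => t ^ (-(1 / 2 : ℝ) - 1) * Real.exp (-((Real.pi * ‖ξ‖ ^ 2) / t)))
    (κ := fun ξ => 1 / ‖ξ‖)
    (by fun_prop) (by fun_prop) (fun t ht y => by positivity)
    (by
      filter_upwards [ae_ne (by omega) 0] with ξ hξ
      have hpos : 0 < ‖ξ‖ := norm_pos_iff.2 hξ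
      have := integral_rpow_mul_exp_neg_div (s := 1 / 2) (a := Real.pi * ‖ξ‖ ^ 2) (by norm_num)
        (by positivity)
      refine ⟨this.1, this.2.trans ?_⟩
      rw [one_div_mul_sq_rpow hpos.le, mul_right_comm, pi_rpow_neg_half_mul_Gamma, one_mul]
      norm_num [Real.rpow_neg_one])
    (by
      refine hF.norm.mono' ?_ (ae_of_all _ fun ξ => ?_)
      · exact (by fun_prop : Measurable _).aestronglyMeasurable
      · simp only [norm_mul, norm_expI, mul_one, le_refl])
  have mid : ∫ t in Set.Ioi (0 : ℝ), ∫ y, h y *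
      ((t ^ (((N : ℝ) - 1) / 2 - 1) * Real.exp (-((Real.pi * ‖x - y‖ ^ 2) * t)) : ℝ) : ℂ) =
      ∫ t in Set.Ioi (0 : ℝ), ∫ ξ, 𝓕 h ξ * Complex.exp (2 * Real.pi * Complex.I * (⟪x, ξ⟫ : ℝ)) *
      ((t ^ (-(1 / 2 : ℝ) - 1) * Real.exp (-((Real.pi * ‖ξ‖ ^ 2) / t)) : ℝ) : ℂ) := by
    refine setIntegral_congr_fun measurableSet_Ioi fun t ht => ?_
    have ht : 0 < t := ht
    have key := integral_fourier_mul_modGauss ht hh x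
    have hc : t ^ (-(1 / 2 : ℝ) - 1) * t ^ ((N : ℝ) / 2) = t ^ (((N : ℝ) - 1) / 2 - 1) := by
      rw [← Real.rpow_add ht]
      congr 1; ring
    have e1 : ∫ y, h y *
        ((t ^ (((N : ℝ) - 1) / 2 - 1) * Real.exp (-((Real.pi * ‖x - y‖ ^ 2) * t)) : ℝ) : ℂ) =
        ((t ^ (((N : ℝ) - 1) / 2 - 1) : ℝ) : ℂ) *
        ∫ y, h y * (Real.exp (-(Real.pi * ‖x - y‖ ^ 2 * t)) : ℝ) := by
      rw [← integral_const_mul]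
      refine integral_congr_ae (ae_of_all _ fun y => ?_)
      simp only [Complex.ofReal_mul]; ring
    rw [e1, ← hc, Complex.ofReal_mul, mul_assoc, ← key, ← integral_const_mul]
    refine integral_congr_ae (ae_of_all _ fun y => ?_)
    simp only [Complex.ofReal_mul, modGauss_eq]; ring
  rw [left, right] at mid
  rw [← mid, ← integral_const_mul]
  refine integral_congr_ae (ae_of_all _ fun y => ?_)
  simp only [Complex.ofReal_mul]; ring

/-! ### Averages of small translates in L¹ -/

lemma continuous_integral_norm_translate_sub {p : E N → ℂ} (hp : Integrable p) :
    Continuous fun z : E N => ∫ x, ‖p (x - z) - p x‖ := by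
  have hp' : MemLp p 1 := memLp_one_iff_integrable.2 hp
  have hmp : ∀ z : E N, MeasurePreserving (fun x : E N => x - z) :=
    fun z => measurePreserving_sub_right volume z
  let g : E N → C(E N, E N) := fun z => ⟨fun x => x - z, by fun_prop⟩
  have hg : Continuous g := by
    refine ContinuousMap.continuous_of_continuous_uncurry _ ?_
    change Continuous fun q : E N × E N => q.2 - q.1
    fun_prop
  have hc : Continuous fun z => Lp.compMeasurePreserving (g z) (hmp z) (hp'.toLp p) :=
    Continuous.compMeasurePreservingLp continuous_const hg hmp ENNReal.one_ne_top
  refine ((hc.sub continuous_const).norm (E := Lp ℂ 1 (volume : Measure (E N)))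
    (f := fun z => Lp.compMeasurePreserving (g z) (hmp z) (hp'.toLp p) - hp'.toLp p)).congr
    fun z => ?_
  rw [Lp.toLp_compMeasurePreserving, ← MemLp.toLp_sub, L1.norm_eq_integral_norm]
  refine integral_congr_ae ?_
  filter_upwards [MemLp.coeFn_toLp ((hp'.comp_measurePreserving (hmp z)).sub hp')] with x hx
  exact congrArg norm hx

/-- The shear `(z, x) ↦ (z, x - ε • z)` preserves Lebesgue measure, so this is a tensor product of
integrable functions pulled back. -/
lemma integrable_prod_mul_translate {p q : E N → ℂ} (hp : Integrable p) (hq : Integrable q)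
    (ε : ℝ) : Integrable (fun w : E N × E N => q w.1 * p (w.2 - ε • w.1))
      (volume.prod volume) := by
  have hmp : MeasurePreserving (fun w : E N × E N => (w.1, w.2 - ε • w.1))
      (volume.prod volume) (volume.prod volume) :=
    MeasurePreserving.skew_product (MeasurePreserving.id volume)
      (g := fun z x => x - ε • z) (by fun_prop)
      (ae_of_all _ fun z => (measurePreserving_sub_right volume (ε • z)).map_eq)
  exact hmp.integrable_comp_of_integrable (hq.mul_prod hp)

/-- By Fubini the distance is at most ∫ |q(z)| τ(εz) dz, where τ is the L¹ modulus of translation of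
`p`: continuous, bounded and zero at the origin. No regularity is asked of `p` or `q`, so either can
later be the window and the other the function being filtered. -/
lemma tendsto_integral_norm_average_translate_sub {p q : E N → ℂ} (hp : Integrable p)
    (hq : Integrable q) {ε : ℕ → ℝ} (hε : Tendsto ε atTop (𝓝 0)) :
    Tendsto (fun n => ∫ x, ‖(∫ z, q z * p (x - ε n • z)) - (∫ z, q z) * p x‖) atTop (𝓝 0) := by
  set τ : E N → ℝ := fun z => ∫ x, ‖p (x - z) - p x‖ with hτ
  have hτc : Continuous τ := continuous_integral_norm_translate_sub hp
  have hτ0 : τ 0 = 0 := by simp [hτ]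
  have hτb : ∀ z, ‖τ z‖ ≤ 2 * ∫ x, ‖p x‖ := by
    intro z
    rw [Real.norm_of_nonneg (integral_nonneg fun x => norm_nonneg _), two_mul]
    have h1 : Integrable fun x => ‖p (x - z)‖ := (hp.comp_sub_right z).norm
    calc τ z ≤ ∫ x, (‖p (x - z)‖ + ‖p x‖) :=
          integral_mono ((hp.comp_sub_right z).sub hp).norm (h1.add hp.norm)
            fun x => norm_sub_le _ _
      _ = _ := by
          rw [integral_add h1 hp.norm, integral_sub_right_eq_self (fun x => ‖p x‖)]
  have hlim : Tendsto (fun n => ∫ z, ‖q z‖ * τ (ε n • z)) atTop (𝓝 0) := by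
    have : (0 : ℝ) = ∫ z : E N, ‖q z‖ * τ ((0 : ℝ) • z) := by simp [hτ0]
    rw [this]
    refine tendsto_integral_of_dominated_convergence
      (fun z => ‖q z‖ * (2 * ∫ x, ‖p x‖)) (fun n => ?_) (hq.norm.mul_const _)
      (fun n => ae_of_all _ fun z => ?_) (ae_of_all _ fun z => ?_)
    · exact hq.1.norm.mul (by fun_prop : Continuous fun z => τ (ε n • z)).aestronglyMeasurable
    · rw [norm_mul, norm_norm]
      gcongr
      exact hτb _
    · exact ((hτc.tendsto _).comp (hε.smul_const z)).const_mul _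
  refine squeeze_zero (fun n => integral_nonneg fun x => norm_nonneg _) (fun n => ?_) hlim
  have hF1 := integrable_prod_mul_translate hp hq (ε n)
  have hF2 : Integrable (fun w : E N × E N => q w.1 * p w.2) (volume.prod volume) := hq.mul_prod hp
  have hF := hF1.sub hF2
  have hFs := hF.swap
  calc ∫ x, ‖(∫ z, q z * p (x - ε n • z)) - (∫ z, q z) * p x‖
      = ∫ x, ‖∫ z, (q z * p (x - ε n • z) - q z * p x)‖ := by
        refine integral_congr_ae ?_
        filter_upwards [hF1.swap.prod_right_ae, hF2.swap.prod_right_ae] with x h1 h2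
        have h1 : Integrable fun z => q z * p (x - ε n • z) := h1
        have h2 : Integrable fun z => q z * p x := h2
        rw [integral_sub h1 h2, integral_mul_const]
    _ ≤ ∫ x, ∫ z, ‖q z * p (x - ε n • z) - q z * p x‖ := by
        refine integral_mono_ae hFs.integral_prod_left.norm hFs.integral_norm_prod_left
          (ae_of_all _ fun x => ?_)
        exact norm_integral_le_integral_norm _
    _ = ∫ z, ∫ x, ‖q z * p (x - ε n • z) - q z * p x‖ := by
        exact integral_integral_swap hFs.norm
    _ = ∫ z, ‖q z‖ * τ (ε n • z) := by
        refine integral_congr_ae (ae_of_all _ fun z => ?_)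
        simp only [← mul_sub, norm_mul]
        rw [integral_const_mul]

/-! ### Band-pass filters and their convergence in L¹ -/

/-- The smooth low-frequency cut-off, equal to one on the unit ball and supported in the ball of
radius two. -/
noncomputable def freqBump (N : ℕ) : ContDiffBump (0 : E N) := ⟨1, 2, one_pos, one_lt_two⟩

noncomputable def cutoff (N : ℕ) : SchwartzMap (E N) ℂ :=
  HasCompactSupport.toSchwartzMap (f := fun ξ : E N => ((freqBump N ξ : ℝ) : ℂ))
    ((freqBump N).hasCompactSupport.comp_left (g := fun r : ℝ => (r : ℂ)) Complex.ofReal_zero)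
    (Complex.ofRealCLM.contDiff.comp (freqBump N).contDiff)

lemma cutoff_apply (ξ : E N) : cutoff N ξ = ((freqBump N ξ : ℝ) : ℂ) := rfl

lemma cutoff_eq_one {ξ : E N} (h : ‖ξ‖ ≤ 1) : cutoff N ξ = 1 := by
  rw [cutoff_apply, (freqBump N).one_of_mem_closedBall (by simpa [freqBump] using h)]
  simp

lemma cutoff_eq_zero {ξ : E N} (h : 2 ≤ ‖ξ‖) : cutoff N ξ = 0 := by
  rw [cutoff_apply, (freqBump N).zero_of_le_dist (by simpa [freqBump] using h)]
  simp

/-- The averaging kernel with Fourier transform `cutoff`. -/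
noncomputable def window (N : ℕ) : SchwartzMap (E N) ℂ := 𝓕⁻ (cutoff N)

lemma fourier_window : 𝓕 (window N : E N → ℂ) = cutoff N := by
  rw [← SchwartzMap.fourier_coe, window, FourierTransform.fourier_fourierInv_eq]

lemma integral_window : ∫ z, window N z = 1 := by
  have h := congrFun (fourier_window (N := N)) 0
  rw [Real.fourier_eq, cutoff_eq_one (by simp)] at h
  simpa using h

/-- Normalised to keep the L¹ norm: an approximate identity as `a → ∞`, an ever wider average as `a
→ 0`. -/
noncomputable def dilate (N : ℕ) (a : ℝ) (z : E N) : ℂ := (a ^ N : ℝ) * window N (a • z)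

lemma continuous_dilate (a : ℝ) : Continuous (dilate N a) := by
  unfold dilate
  exact continuous_const.mul ((window N).continuous.comp (continuous_const_smul a))

lemma integrable_dilate {a : ℝ} (ha : 0 < a) : Integrable (dilate N a) :=
  ((window N).integrable.comp_smul ha.ne').const_mul _

lemma fourier_dilate {a : ℝ} (ha : 0 < a) (ξ : E N) :
    𝓕 (dilate N a) ξ = cutoff N (a⁻¹ • ξ) := by
  rw [← congrFun fourier_window, Real.fourier_eq, Real.fourier_eq]
  have h := Measure.integral_comp_smul (volume : Measure (E N))
    (fun z => Real.fourierChar (-⟪z, a⁻¹ • ξ⟫) • window N z) a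
  have e : ∀ z : E N, ⟪a • z, a⁻¹ • ξ⟫ = ⟪z, ξ⟫ := fun z => by
    rw [real_inner_smul_left, real_inner_smul_right, mul_inv_cancel_left₀ ha.ne']
  simp only [e, finrank_euclideanSpace_fin] at h
  have h2 : (∫ z, Real.fourierChar (-⟪z, ξ⟫) • dilate N a z) =
      ((a ^ N : ℝ) : ℂ) * ∫ z, Real.fourierChar (-⟪z, ξ⟫) • window N (a • z) := by
    rw [← integral_const_mul]
    refine integral_congr_ae (ae_of_all _ fun z => ?_)
    simp only [dilate, Circle.smul_def, smul_eq_mul]; ring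
  rw [h2, h, abs_of_pos (by positivity), Complex.real_smul, ← mul_assoc, ← Complex.ofReal_mul,
    mul_inv_cancel₀ (by positivity), Complex.ofReal_one, one_mul]

noncomputable def bandKernel (N n : ℕ) (z : E N) : ℂ :=
  dilate N (n + 1) z - dilate N ((n + 1 : ℝ)⁻¹) z

noncomputable def bandSymbol (N n : ℕ) (ξ : E N) : ℂ :=
  cutoff N ((n + 1 : ℝ)⁻¹ • ξ) - cutoff N ((n + 1 : ℝ) • ξ)

/-- Restriction of `h` to frequencies between `1 / (n + 1)` and `2 (n + 1)`. -/
noncomputable def bandPass (n : ℕ) (h : E N → ℂ) (x : E N) : ℂ :=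
  ∫ y, h y * bandKernel N n (x - y)

lemma integrable_bandKernel (n : ℕ) : Integrable (bandKernel N n) :=
  (integrable_dilate (by positivity)).sub (integrable_dilate (by positivity))

lemma continuous_bandKernel (n : ℕ) : Continuous (bandKernel N n) :=
  (continuous_dilate _).sub (continuous_dilate _)

lemma fourier_sub {f g : E N → ℂ} (hf : Integrable f) (hg : Integrable g) (ξ : E N) :
    𝓕 (fun x => f x - g x) ξ = 𝓕 f ξ - 𝓕 g ξ := by
  rw [Real.fourier_eq, Real.fourier_eq, Real.fourier_eq, ← integral_sub
    ((Real.fourierIntegral_convergent_iff ξ).2 hf) ((Real.fourierIntegral_convergent_iff ξ).2 hg)]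
  simp only [smul_sub]

lemma fourier_bandKernel (n : ℕ) (ξ : E N) : 𝓕 (bandKernel N n) ξ = bandSymbol N n ξ := by
  have := fourier_sub (integrable_dilate (N := N) (by positivity : 0 < (n + 1 : ℝ)))
    (integrable_dilate (N := N) (by positivity : 0 < (n + 1 : ℝ)⁻¹)) ξ
  rw [fourier_dilate (by positivity), fourier_dilate (by positivity), inv_inv] at this
  exact this

lemma contDiff_bandSymbol (n : ℕ) : ContDiff ℝ ∞ (bandSymbol N n) :=
  ((cutoff N).smooth'.comp (contDiff_const_smul _)).sub
    ((cutoff N).smooth'.comp (contDiff_const_smul _))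

/-- Both cut-offs equal one there. This gap at the origin is what allows division by `‖ξ‖ ^ N`. -/
lemma bandSymbol_eq_zero_of_norm_le {n : ℕ} {ξ : E N} (h : ‖ξ‖ ≤ (n + 1 : ℝ)⁻¹) :
    bandSymbol N n ξ = 0 := by
  have hn : (0 : ℝ) < n + 1 := by positivity
  have hn1 : (n + 1 : ℝ)⁻¹ ≤ 1 := inv_le_one_of_one_le₀ (by linarith [n.cast_nonneg (α := ℝ)])
  rw [bandSymbol, cutoff_eq_one, cutoff_eq_one, sub_self]
  · rw [norm_smul, Real.norm_of_nonneg hn.le]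
    calc (n + 1 : ℝ) * ‖ξ‖ ≤ (n + 1) * (n + 1 : ℝ)⁻¹ := by gcongr
      _ = 1 := mul_inv_cancel₀ hn.ne'
  · rw [norm_smul, Real.norm_of_nonneg (by positivity)]
    exact mul_le_one₀ hn1 (norm_nonneg _) (h.trans hn1)

lemma bandSymbol_eq_zero_of_le_norm {n : ℕ} {ξ : E N} (h : 2 * (n + 1 : ℝ) ≤ ‖ξ‖) :
    bandSymbol N n ξ = 0 := by
  have hn : (0 : ℝ) < n + 1 := by positivity
  have hn1 : (1 : ℝ) ≤ n + 1 := by linarith [n.cast_nonneg (α := ℝ)]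
  rw [bandSymbol, cutoff_eq_zero, cutoff_eq_zero, sub_self]
  · rw [norm_smul, Real.norm_of_nonneg hn.le]; nlinarith
  · rw [norm_smul, Real.norm_of_nonneg (by positivity)]
    rw [inv_mul_eq_div, le_div_iff₀ hn]; exact h

lemma hasCompactSupport_bandSymbol (n : ℕ) : HasCompactSupport (bandSymbol N n) :=
  HasCompactSupport.of_support_subset_isCompact (isCompact_closedBall (0 : E N) (2 * (n + 1 : ℝ)))
    fun ξ hξ => by
      rw [mem_closedBall_zero_iff]
      by_contra hlt
      exact hξ (bandSymbol_eq_zero_of_le_norm (not_le.1 hlt).le)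

lemma continuous_fourier {h : E N → ℂ} (hh : Integrable h) : Continuous (𝓕 h) :=
  VectorFourier.fourierIntegral_continuous Real.continuous_fourierChar continuous_inner hh

lemma bandPass_eq_convolution (n : ℕ) (h : E N → ℂ) :
    bandPass n h = convolution h (bandKernel N n) (ContinuousLinearMap.mul ℂ ℂ) := rfl

lemma integrable_bandPass (n : ℕ) {h : E N → ℂ} (hh : Integrable h) : Integrable (bandPass n h) :=
  hh.integrable_convolution (ContinuousLinearMap.mul ℂ ℂ) (integrable_bandKernel n)

lemma exists_norm_bandKernel_le (n : ℕ) : ∃ C, ∀ z : E N, ‖bandKernel N n z‖ ≤ C := by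
  obtain ⟨C, hC⟩ := (window N).decay 0 0
  refine ⟨‖(((n + 1 : ℝ)) ^ N : ℝ)‖ * C + ‖(((n + 1 : ℝ)⁻¹) ^ N : ℝ)‖ * C, fun z => ?_⟩
  have hw : ∀ z, ‖window N z‖ ≤ C := fun z => by simpa using hC.2 z
  refine (norm_sub_le _ _).trans ?_
  rw [dilate, dilate, norm_mul, norm_mul, Complex.norm_real, Complex.norm_real]
  gcongr <;> exact hw _

lemma continuous_bandPass (n : ℕ) {h : E N → ℂ} (hh : Integrable h) : Continuous (bandPass n h) := by
  obtain ⟨C, hC⟩ := exists_norm_bandKernel_le (N := N) n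
  refine continuous_of_dominated (bound := fun y => ‖h y‖ * C) (fun x => ?_)
    (fun x => ae_of_all _ fun y => ?_) (hh.norm.mul_const C) (ae_of_all _ fun y => ?_)
  · exact hh.1.mul ((continuous_bandKernel n).comp (by fun_prop)).aestronglyMeasurable
  · rw [norm_mul]; gcongr; exact hC _
  · exact continuous_const.mul ((continuous_bandKernel n).comp (by fun_prop))

lemma fourier_bandPass (n : ℕ) {h : E N → ℂ} (hh : Integrable h) (ξ : E N) :
    𝓕 (bandPass n h) ξ = 𝓕 h ξ * bandSymbol N n ξ := by
  rw [bandPass_eq_convolution, Real.fourier_mul_convolution_eq hh (integrable_bandKernel n),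
    fourier_bandKernel]

lemma integrable_mul_of_hasCompactSupport {g k : E N → ℂ} (hg : Continuous g) (hk : Continuous k)
    (hs : HasCompactSupport k) : Integrable (fun ξ => g ξ * k ξ) :=
  (hg.mul hk).integrable_of_hasCompactSupport hs.mul_left

lemma bandPass_eq_fourierInv (n : ℕ) {h : E N → ℂ} (hh : Integrable h) :
    bandPass n h = 𝓕⁻ (fun ξ => 𝓕 h ξ * bandSymbol N n ξ) := by
  have e : 𝓕 (bandPass n h) = fun ξ => 𝓕 h ξ * bandSymbol N n ξ :=
    funext fun ξ => fourier_bandPass n hh ξ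
  rw [← e, Continuous.fourierInv_fourier_eq (continuous_bandPass n hh) (integrable_bandPass n hh)]
  rw [e]
  exact integrable_mul_of_hasCompactSupport (continuous_fourier hh)
    (contDiff_bandSymbol n).continuous (hasCompactSupport_bandSymbol n)

lemma convolution_dilate_eq {h : E N → ℂ} {a : ℝ} (ha : 0 < a) (x : E N) :
    ∫ y, h y * dilate N a (x - y) = ∫ z, window N z * h (x - a⁻¹ • z) := by
  have h1 : ∫ y, h y * dilate N a (x - y) = ∫ y, h (x - y) * dilate N a y := by
    rw [← integral_sub_left_eq_self (fun y => h y * dilate N a (x - y)) volume x]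
    simp
  have h2 := Measure.integral_comp_smul (volume : Measure (E N))
    (fun z => window N z * h (x - a⁻¹ • z)) a
  simp only [inv_smul_smul₀ ha.ne', finrank_euclideanSpace_fin] at h2
  rw [h1]
  have h3 : ∫ y, h (x - y) * dilate N a y =
      ((a ^ N : ℝ) : ℂ) * ∫ y, window N (a • y) * h (x - y) := by
    rw [← integral_const_mul]
    refine integral_congr_ae (ae_of_all _ fun z => ?_)
    simp only [dilate]; ring
  rw [h3, h2, abs_of_pos (by positivity), Complex.real_smul, ← mul_assoc, ← Complex.ofReal_mul,
    mul_inv_cancel₀ (by positivity), Complex.ofReal_one, one_mul]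

/-- Rescaling `x` exchanges roles: the wide average of `h` becomes an average, with weight `h`, of
translates of the window by `a • y`, which are small when `a` is. -/
lemma integral_norm_convolution_dilate (h : E N → ℂ) {a : ℝ} (ha : 0 < a) :
    ∫ x, ‖∫ y, h y * dilate N a (x - y)‖ = ∫ x, ‖∫ y, h y * window N (x - a • y)‖ := by
  have h2 := Measure.integral_comp_smul (volume : Measure (E N))
    (fun x => ‖∫ y, h y * window N (x - a • y)‖) a
  simp only [finrank_euclideanSpace_fin] at h2
  have h3 : ∀ x, ‖∫ y, h y * dilate N a (x - y)‖ =
      a ^ N * ‖∫ y, h y * window N (a • x - a • y)‖ := by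
    intro x
    rw [← Real.norm_of_nonneg (by positivity : 0 ≤ a ^ N), ← Complex.norm_real, ← norm_mul,
      ← integral_const_mul]
    congr 1
    refine integral_congr_ae (ae_of_all _ fun z => ?_)
    simp only [dilate, smul_sub]; ring
  simp_rw [h3]
  rw [integral_const_mul, h2, abs_of_pos (by positivity), smul_eq_mul, ← mul_assoc,
    mul_inv_cancel₀ (by positivity), one_mul]

lemma integrable_mul_dilate {h : E N → ℂ} (hh : Integrable h) {a : ℝ} (ha : 0 < a) (x : E N) :
    Integrable (fun y => h y * dilate N a (x - y)) := by
  obtain ⟨C, hC⟩ := (window N).decay 0 0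
  have hw : ∀ z, ‖window N z‖ ≤ C := fun z => by simpa using hC.2 z
  refine (hh.norm.mul_const (a ^ N * C)).mono'
    (hh.1.mul ((continuous_dilate a).comp (by fun_prop)).aestronglyMeasurable)
    (ae_of_all _ fun y => ?_)
  rw [norm_mul, dilate, norm_mul, Complex.norm_real, Real.norm_of_nonneg (by positivity)]
  gcongr
  exact hw _

lemma bandPass_eq_sub (n : ℕ) {h : E N → ℂ} (hh : Integrable h) (x : E N) :
    bandPass n h x = (∫ y, h y * dilate N (n + 1) (x - y)) -
      ∫ y, h y * dilate N ((n + 1 : ℝ)⁻¹) (x - y) := by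
  rw [← integral_sub (integrable_mul_dilate hh (by positivity) x)
    (integrable_mul_dilate hh (by positivity) x)]
  simp only [bandPass, bandKernel, mul_sub]

lemma integrable_convolution_dilate {h : E N → ℂ} (hh : Integrable h) {a : ℝ} (ha : 0 < a) :
    Integrable (fun x => ∫ y, h y * dilate N a (x - y)) :=
  hh.integrable_convolution (ContinuousLinearMap.mul ℂ ℂ) (integrable_dilate ha)

/-- The narrow kernel is an approximate identity. The wide one contributes, after exchanging roles,
an average of translates of the window with weight `h`; its L¹ limit is the window times the
integral of `h`, which is why mean zero is required. -/
theorem tendsto_integral_norm_bandPass_sub {h : E N → ℂ} (hh : Integrable h)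
    (h0 : ∫ y, h y = 0) :
    Tendsto (fun n => ∫ x, ‖bandPass n h x - h x‖) atTop (𝓝 0) := by
  have hinv : Tendsto (fun n : ℕ => ((n : ℝ) + 1)⁻¹) atTop (𝓝 0) := by
    simpa [one_div] using tendsto_one_div_add_atTop_nhds_zero_nat (𝕜 := ℝ)
  have t1 := tendsto_integral_norm_average_translate_sub hh (window N).integrable hinv
  have t2 := tendsto_integral_norm_average_translate_sub (window N).integrable hh hinv
  simp only [integral_window, one_mul, h0, zero_mul, sub_zero] at t1 t2
  have t := t1.add t2
  rw [add_zero] at t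
  refine squeeze_zero (fun n => integral_nonneg fun x => norm_nonneg _) (fun n => ?_) t
  have hn : (0 : ℝ) < n + 1 := by positivity
  have hn' : (0 : ℝ) < (n + 1 : ℝ)⁻¹ := by positivity
  rw [← integral_norm_convolution_dilate h hn']
  simp_rw [← convolution_dilate_eq hn (h := h)]
  have i1 : Integrable fun x => ‖(∫ y, h y * dilate N (n + 1) (x - y)) - h x‖ :=
    ((integrable_convolution_dilate hh hn).sub hh).norm
  have i2 := (integrable_convolution_dilate hh hn').norm
  rw [← integral_add i1 i2]
  refine integral_mono ((integrable_bandPass n hh).sub hh).norm (i1.add i2) fun x => ?_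
  simp only [bandPass_eq_sub n hh x]
  rw [sub_right_comm]
  exact norm_sub_le _ _

/-! ### Spatial decay of band-passed functions, uniform in the band -/

lemma exists_window_decay (N : ℕ) : ∃ C : ℝ, 0 ≤ C ∧ (∀ z : E N, ‖window N z‖ ≤ C) ∧
    (∀ z : E N, ‖z‖ ^ (N + 1) * ‖window N z‖ ≤ C) ∧
    (∀ z : E N, ‖z‖ ^ (N + 1) * ‖fderiv ℝ (window N) z‖ ≤ C) := by
  obtain ⟨C₁, h₁, H₁⟩ := (window N).decay 0 0
  obtain ⟨C₂, h₂, H₂⟩ := (window N).decay (N + 1) 0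
  obtain ⟨C₃, h₃, H₃⟩ := (window N).decay (N + 1) 1
  refine ⟨C₁ + C₂ + C₃, by positivity, fun z => ?_, fun z => ?_, fun z => ?_⟩
  · have := H₁ z; simp at this; linarith
  · have := H₂ z; simp at this; linarith
  · have := H₃ z; rw [norm_iteratedFDeriv_one] at this; linarith

lemma norm_integral_mul_le {f g : E N → ℂ} {ρ D : ℝ} (hf : Integrable f)
    (hsupp : ∀ y, ρ < ‖y‖ → f y = 0) (hg : ∀ y, ‖y‖ ≤ ρ → ‖g y‖ ≤ D) :
    ‖∫ y, f y * g y‖ ≤ (∫ y, ‖f y‖) * D := by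
  rw [← integral_mul_const]
  refine norm_integral_le_of_norm_le (hf.norm.mul_const D) (ae_of_all _ fun y => ?_)
  rw [norm_mul]
  by_cases hy : ρ < ‖y‖
  · simp [hsupp y hy]
  · gcongr
    exact hg y (not_lt.1 hy)

lemma half_norm_le_norm_sub {ρ : ℝ} {x y : E N} (hx : 2 * ρ ≤ ‖x‖) (hy : ‖y‖ ≤ ρ) :
    ‖x‖ / 2 ≤ ‖x - y‖ := by
  have := norm_sub_norm_le x y
  linarith

lemma norm_le_div_of_pow_mul_le {a b R C : ℝ} {k : ℕ} (hR : 0 < R) (hRb : R ≤ b) (ha : 0 ≤ a)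
    (h : b ^ k * a ≤ C) : a ≤ C / R ^ k := by
  rw [le_div_iff₀ (by positivity), mul_comm]
  refine le_trans ?_ h
  gcongr

/-- Decay of the window to order `N + 1` beats the normalisation `a ^ N` by a factor `a⁻¹ ≤ 1`, so
the bound is uniform in `a ≥ 1`. -/
lemma norm_convolution_dilate_le_of_far {f : E N → ℂ} {ρ C : ℝ} (hρ : 1 ≤ ρ) (hf : Integrable f)
    (hsupp : ∀ y, ρ < ‖y‖ → f y = 0) (hC : ∀ z : E N, ‖z‖ ^ (N + 1) * ‖window N z‖ ≤ C)
    {a : ℝ} (ha : 1 ≤ a) {x : E N} (hx : 2 * ρ ≤ ‖x‖) :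
    ‖∫ y, f y * dilate N a (x - y)‖ ≤ (∫ y, ‖f y‖) * (C * (2 / ‖x‖) ^ (N + 1)) := by
  have hx0 : 0 < ‖x‖ := by linarith
  have ha0 : 0 < a := by linarith
  have hC0 : 0 ≤ C := le_trans (by positivity) (hC 0)
  refine norm_integral_mul_le hf hsupp fun y hy => ?_
  rw [dilate, norm_mul, Complex.norm_real, Real.norm_of_nonneg (by positivity)]
  have h1 : ‖window N (a • (x - y))‖ ≤ C / (a * (‖x‖ / 2)) ^ (N + 1) := by
    refine norm_le_div_of_pow_mul_le (by positivity) ?_ (norm_nonneg _) (hC (a • (x - y)))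
    rw [norm_smul, Real.norm_of_nonneg ha0.le]
    gcongr
    exact half_norm_le_norm_sub hx hy
  calc a ^ N * ‖window N (a • (x - y))‖ ≤ a ^ N * (C / (a * (‖x‖ / 2)) ^ (N + 1)) := by gcongr
    _ = C * (2 / ‖x‖) ^ (N + 1) * a⁻¹ := by
        rw [mul_pow, div_pow, div_pow, pow_succ a]; field_simp
    _ ≤ C * (2 / ‖x‖) ^ (N + 1) * 1 := by gcongr; exact inv_le_one_of_one_le₀ ha
    _ = _ := mul_one _

/-- The tail bound alone would lose `b⁻¹` for small `b`. Mean zero allows the kernel at `x` to be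
subtracted, and the mean value inequality then gains the factor `b * ρ`. -/
lemma norm_convolution_dilate_le_of_mean_zero {f : E N → ℂ} {ρ C : ℝ} (hρ : 1 ≤ ρ)
    (hf : Integrable f) (hsupp : ∀ y, ρ < ‖y‖ → f y = 0) (h0 : ∫ y, f y = 0)
    (hC : ∀ z : E N, ‖z‖ ^ (N + 1) * ‖fderiv ℝ (window N) z‖ ≤ C)
    {b : ℝ} (hb : 0 < b) {x : E N} (hx : 2 * ρ ≤ ‖x‖) :
    ‖∫ y, f y * dilate N b (x - y)‖ ≤ (∫ y, ‖f y‖) * (ρ * C * (2 / ‖x‖) ^ (N + 1)) := by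
  have hx0 : 0 < ‖x‖ := by linarith
  have hC0 : 0 ≤ C := le_trans (by positivity) (hC 0)
  have e : ∫ y, f y * dilate N b (x - y) =
      ∫ y, f y * (dilate N b (x - y) - dilate N b x) := by
    simp_rw [mul_sub]
    rw [integral_sub (integrable_mul_dilate hf hb x) (hf.mul_const _), integral_mul_const, h0,
      zero_mul, sub_zero]
  rw [e]
  refine norm_integral_mul_le hf hsupp fun y hy => ?_
  have hpos : 0 < b * (‖x‖ / 2) := by positivity
  have hmv : ‖window N (b • (x - y)) - window N (b • x)‖ ≤
      C / (b * (‖x‖ / 2)) ^ (N + 1) * ‖b • (x - y) - b • x‖ := by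
    refine (convex_segment (b • x) (b • (x - y))).norm_image_sub_le_of_norm_fderiv_le (𝕜 := ℝ)
      (fun z _ => (window N).differentiableAt) (fun z hz => ?_) (left_mem_segment ℝ _ _)
      (right_mem_segment ℝ _ _)
    refine norm_le_div_of_pow_mul_le hpos ?_ (norm_nonneg _) (hC z)
    -- Points of the segment are `b • (x - s • y)` with `‖s • y‖ ≤ ρ`, so they all stay at norm at
    -- least `b * (‖x‖ / 2)`.
    obtain ⟨s, hs, rfl⟩ := (segment_eq_image' ℝ (b • x) (b • (x - y))) ▸ hz
    have e2 : b • x + s • (b • (x - y) - b • x) = b • (x - s • y) := by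
      module
    beta_reduce
    rw [e2, norm_smul, Real.norm_of_nonneg hb.le]
    gcongr
    refine half_norm_le_norm_sub hx ?_
    rw [norm_smul, Real.norm_of_nonneg hs.1]
    exact (mul_le_of_le_one_left (norm_nonneg _) hs.2).trans hy
  have e3 : ‖b • (x - y) - b • x‖ ≤ b * ρ := by
    rw [← smul_sub, norm_smul, Real.norm_of_nonneg hb.le]
    gcongr
    simpa using hy
  rw [dilate, dilate, ← mul_sub, norm_mul, Complex.norm_real, Real.norm_of_nonneg (by positivity)]
  calc b ^ N * ‖window N (b • (x - y)) - window N (b • x)‖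
      ≤ b ^ N * (C / (b * (‖x‖ / 2)) ^ (N + 1) * (b * ρ)) := by
        gcongr
        exact hmv.trans (by gcongr)
    _ = _ := by
        rw [mul_pow, div_pow, div_pow, pow_succ b]; field_simp

lemma norm_convolution_dilate_le_of_bounded {f : E N → ℂ} {A : ℝ}
    (hA : ∀ᵐ y, ‖f y‖ ≤ A) {a : ℝ} (ha : 0 < a) (x : E N) :
    ‖∫ y, f y * dilate N a (x - y)‖ ≤ A * ∫ z, ‖window N z‖ := by
  have hi := ((integrable_dilate (N := N) ha).comp_sub_left x).norm
  have h2 := Measure.integral_comp_smul (volume : Measure (E N)) (fun z => ‖window N z‖) a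
  simp only [finrank_euclideanSpace_fin] at h2
  have h3 : ∫ z, ‖dilate N a z‖ = ∫ z, ‖window N z‖ := by
    simp only [dilate, norm_mul, Complex.norm_real]
    rw [integral_const_mul, h2, abs_of_pos (by positivity), Real.norm_of_nonneg (by positivity),
      smul_eq_mul, ← mul_assoc, mul_inv_cancel₀ (by positivity), one_mul]
  rw [← h3, ← integral_sub_left_eq_self (fun z => ‖dilate N a z‖) volume x, ← integral_const_mul]
  refine norm_integral_le_of_norm_le (hi.const_mul A) ?_
  filter_upwards [hA] with y hy
  rw [norm_mul]
  gcongr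

/-- Uniform decay of the band-limited pieces of a bounded compactly supported function of mean
zero. -/
lemma exists_norm_bandPass_le {f : E N → ℂ} {A ρ : ℝ} (hf : Integrable f)
    (hA : ∀ᵐ y, ‖f y‖ ≤ A) (hρ : 1 ≤ ρ) (hsupp : ∀ y, ρ < ‖y‖ → f y = 0) (h0 : ∫ y, f y = 0) :
    ∃ C : ℝ, ∀ n x, ‖bandPass n f x‖ ≤ C / (1 + ‖x‖) ^ (N + 1) := by
  obtain ⟨C, hC0, hC1, hC2, hC3⟩ := exists_window_decay N
  have hA0 : 0 ≤ A := by
    obtain ⟨y, hy⟩ := hA.exists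
    exact (norm_nonneg _).trans hy
  set I := ∫ y, ‖f y‖ with hI
  have hI0 : 0 ≤ I := integral_nonneg fun y => norm_nonneg _
  set W := ∫ z, ‖window N z‖ with hW
  have hW0 : 0 ≤ W := integral_nonneg fun y => norm_nonneg _
  refine ⟨(A * W + I * C) * (1 + 2 * ρ) ^ (N + 1) +
    (I * (C * 4 ^ (N + 1)) + I * (ρ * C * 4 ^ (N + 1))), fun n x => ?_⟩
  have hn : (1 : ℝ) ≤ n + 1 := by linarith [n.cast_nonneg (α := ℝ)]
  have hn0 : (0 : ℝ) < n + 1 := by linarith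
  have hn1 : (n + 1 : ℝ)⁻¹ ≤ 1 := inv_le_one_of_one_le₀ hn
  rw [bandPass_eq_sub n hf]
  refine (norm_sub_le _ _).trans ?_
  rw [le_div_iff₀ (by positivity)]
  -- Near the support the weight is bounded: the narrow kernel is controlled by the sup of `f`, the
  -- wide one by its L¹ norm because its prefactor is at most one. Away from the support the two
  -- far-field estimates apply.
  rcases le_total ‖x‖ (2 * ρ) with hx | hx
  · have b1 := norm_convolution_dilate_le_of_bounded hA hn0 x
    have b2 : ‖∫ y, f y * dilate N ((n + 1 : ℝ)⁻¹) (x - y)‖ ≤ I * C := by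
      refine norm_integral_mul_le hf hsupp fun y _ => ?_
      rw [dilate, norm_mul, Complex.norm_real, Real.norm_of_nonneg (by positivity)]
      exact (mul_le_of_le_one_left (norm_nonneg _) (pow_le_one₀ (by positivity) hn1)).trans (hC1 _)
    calc _ ≤ (A * W + I * C) * (1 + 2 * ρ) ^ (N + 1) := by gcongr
      _ ≤ _ := le_add_of_nonneg_right (by positivity)
  · have hx0 : 0 < ‖x‖ := by linarith
    have b1 := norm_convolution_dilate_le_of_far hρ hf hsupp hC2 hn hx
    have b2 := norm_convolution_dilate_le_of_mean_zero hρ hf hsupp h0 hC3 (inv_pos.2 hn0) hx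
    have b3 : (2 / ‖x‖) ^ (N + 1) * (1 + ‖x‖) ^ (N + 1) ≤ 4 ^ (N + 1) := by
      rw [← mul_pow]
      gcongr
      rw [div_mul_eq_mul_div, div_le_iff₀ hx0]
      linarith
    calc _ ≤ (I * (C * (2 / ‖x‖) ^ (N + 1)) + I * (ρ * C * (2 / ‖x‖) ^ (N + 1))) *
          (1 + ‖x‖) ^ (N + 1) := by gcongr
      _ = (I * C + I * (ρ * C)) * ((2 / ‖x‖) ^ (N + 1) * (1 + ‖x‖) ^ (N + 1)) := by ring
      _ ≤ (I * C + I * (ρ * C)) * 4 ^ (N + 1) := by gcongr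
      _ = I * (C * 4 ^ (N + 1)) + I * (ρ * C * 4 ^ (N + 1)) := by ring
      _ ≤ _ := le_add_of_nonneg_left (by positivity)

/-! ### Testing the equation for u with band-limited potentials -/

/-- The Fourier transform of the band-limited solution `φ` of `(-Δ)^(N/2) φ = bandPass n f`. -/
noncomputable def potentialSymbol (n : ℕ) (f : E N → ℂ) (ξ : E N) : ℂ :=
  𝓕 f ξ * (bandSymbol N n ξ * ((2 * Real.pi * ‖ξ‖) ^ (-(N : ℝ)) : ℝ))

/-- The power is singular only at the origin, where the symbol vanishes on a whole ball. -/
lemma contDiff_bandSymbol_mul_rpow (n : ℕ) (s : ℝ) :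
    ContDiff ℝ ∞ fun ξ : E N => bandSymbol N n ξ * ((2 * Real.pi * ‖ξ‖) ^ s : ℝ) := by
  rw [contDiff_iff_contDiffAt]
  intro ξ
  rcases eq_or_ne ξ 0 with rfl | hξ
  · have hev : (fun ξ : E N => bandSymbol N n ξ * ((2 * Real.pi * ‖ξ‖) ^ s : ℝ)) =ᶠ[𝓝 0]
        fun _ => 0 := by
      filter_upwards [Metric.closedBall_mem_nhds (0 : E N) (by positivity : 0 < (n + 1 : ℝ)⁻¹)]
        with ξ hξ
      rw [bandSymbol_eq_zero_of_norm_le (mem_closedBall_zero_iff.1 hξ), zero_mul]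
    exact contDiffAt_const.congr_of_eventuallyEq hev
  · refine (contDiff_bandSymbol n).contDiffAt.mul
      (Complex.ofRealCLM.contDiff.contDiffAt.comp ξ (ContDiffAt.rpow_const_of_ne ?_ ?_))
    · exact contDiffAt_const.mul (contDiffAt_norm ℝ hξ)
    · have := Real.pi_pos
      have := norm_pos_iff.2 hξ
      positivity

lemma contDiff_fourier_of_compact_support {f : E N → ℂ} {ρ : ℝ} (hf : Integrable f)
    (hsupp : ∀ y, ρ < ‖y‖ → f y = 0) : ContDiff ℝ ∞ (𝓕 f) := by
  refine Real.contDiff_fourier (N := ⊤) fun n _ => ?_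
  refine (hf.norm.const_mul (ρ ^ n)).mono'
    ((continuous_norm.pow n).aestronglyMeasurable.mul hf.1.norm) (ae_of_all _ fun y => ?_)
  rw [norm_mul, norm_norm, norm_pow, norm_norm]
  by_cases hy : ρ < ‖y‖
  · simp [hsupp y hy]
  · gcongr
    exact not_lt.1 hy

/-- The two powers of `‖ξ‖` cancel away from the origin; at the origin the symbol is zero, so the
conventions for powers of zero do not matter. -/
lemma fracLaplacian_apply_of_fourier_eq {f : E N → ℂ} {n : ℕ} (hf : Integrable f)
    {φ : SchwartzMap (E N) ℂ}
    (hφ : 𝓕 (φ : E N → ℂ) = potentialSymbol n f) :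
    fracLaplacian (N : ℝ) φ = bandPass n f := by
  rw [bandPass_eq_fourierInv n hf, fracLaplacian, hφ]
  congr 1
  ext ξ
  rcases eq_or_ne ξ 0 with rfl | hξ
  · simp [potentialSymbol, bandSymbol_eq_zero_of_norm_le (N := N) (n := n) (ξ := 0)
      (by rw [norm_zero]; positivity)]
  · have h : 0 < 2 * Real.pi * ‖ξ‖ := by
      have := Real.pi_pos
      have := norm_pos_iff.2 hξ
      positivity
    have e : ((2 * Real.pi * ‖ξ‖) ^ (N : ℝ) : ℝ) * (2 * Real.pi * ‖ξ‖) ^ (-(N : ℝ)) = 1 := by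
      rw [← Real.rpow_add h, add_neg_cancel, Real.rpow_zero]
    rw [potentialSymbol]
    calc _ = 𝓕 f ξ * bandSymbol N n ξ * (((2 * Real.pi * ‖ξ‖) ^ (N : ℝ) : ℝ) *
          ((2 * Real.pi * ‖ξ‖) ^ (-(N : ℝ)) : ℝ) : ℂ) := by ring
      _ = _ := by rw [← Complex.ofReal_mul, e, Complex.ofReal_one, mul_one]

lemma norm_signedIntegral_le (μ : SignedMeasure (E N)) {φ : E N → ℂ} {K : ℝ}
    (h : ∀ x, ‖φ x‖ ≤ K) :
    ‖signedIntegral μ φ‖ ≤ K * (μ.totalVariation Set.univ).toReal := by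
  have h1 := norm_integral_le_of_norm_le_const (μ := μ.toJordanDecomposition.posPart)
    (ae_of_all _ h)
  have h2 := norm_integral_le_of_norm_le_const (μ := μ.toJordanDecomposition.negPart)
    (ae_of_all _ h)
  rw [SignedMeasure.totalVariation, Measure.add_apply,
    ENNReal.toReal_add (measure_ne_top _ _) (measure_ne_top _ _), mul_add]
  exact (norm_sub_le _ _).trans (add_le_add h1 h2)

lemma exists_subseq_bandPass_tendsto_ae {f : E N → ℂ} (hf : Integrable f) (h0 : ∫ y, f y = 0) :
    ∃ s : ℕ → ℕ, StrictMono s ∧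
      ∀ᵐ x, Tendsto (fun i => bandPass (s i) f x) atTop (𝓝 (f x)) := by
  refine TendstoInMeasure.exists_seq_tendsto_ae (tendstoInMeasure_of_tendsto_eLpNorm
    (p := 1) one_ne_zero (fun n => (integrable_bandPass n hf).1) hf.1 ?_)
  have h := tendsto_integral_norm_bandPass_sub hf h0
  have h' := ENNReal.tendsto_ofReal h
  rw [ENNReal.ofReal_zero] at h'
  refine h'.congr fun n => ?_
  rw [eLpNorm_one_eq_lintegral_enorm]
  exact ofReal_integral_norm_eq_lintegral_enorm ((integrable_bandPass n hf).sub hf)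

/-- If the band-limited potentials of `f` are asymptotically bounded by `K₀`, then testing `u`
against `f` costs at most `K₀` times the mass of `(-Δ)^(N/2) u`. -/
theorem abs_integral_mul_le_of_potential_le {u : E N → ℝ}
    (hu : Integrable (fun x => u x / (1 + ‖x‖) ^ (N + 1))) {μ : SignedMeasure (E N)}
    (hμ : HasFracLaplacian (N : ℝ) u μ) {f : E N → ℝ} {A ρ : ℝ} (hf : Integrable f)
    (hA : ∀ᵐ y, ‖f y‖ ≤ A) (hρ : 1 ≤ ρ) (hsupp : ∀ y, ρ < ‖y‖ → f y = 0) (h0 : ∫ y, f y = 0)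
    {K : ℕ → ℝ} {K₀ : ℝ}
    (hK : ∀ n x, ‖𝓕⁻ (potentialSymbol n (fun y => (f y : ℂ))) x‖ ≤ K n)
    (hlim : Tendsto K atTop (𝓝 K₀)) :
    |∫ x, u x * f x| ≤ K₀ * (μ.totalVariation Set.univ).toReal := by
  set fc : E N → ℂ := fun y => (f y : ℂ) with hfc
  have hfi : Integrable fc := hf.ofReal
  have hfs : ∀ y, ρ < ‖y‖ → fc y = 0 := fun y hy => by simp [hfc, hsupp y hy]
  have hfA : ∀ᵐ y, ‖fc y‖ ≤ A := by
    filter_upwards [hA] with y hy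
    simpa [hfc] using hy
  have hf0 : ∫ y, fc y = 0 := by rw [hfc, integral_complex_ofReal, h0, Complex.ofReal_zero]
  have test : ∀ n, ‖∫ x, (u x : ℂ) * bandPass n fc x‖ ≤
      K n * (μ.totalVariation Set.univ).toReal := by
    intro n
    -- The symbol is smooth with compact support, so its inverse transform is an admissible Schwartz
    -- test function.
    have hcs : HasCompactSupport (potentialSymbol n fc) :=
      ((hasCompactSupport_bandSymbol n).mul_right).mul_left
    have hcd : ContDiff ℝ ∞ (potentialSymbol n fc) :=
      (contDiff_fourier_of_compact_support hfi hfs).mul (contDiff_bandSymbol_mul_rpow n _)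
    set q : SchwartzMap (E N) ℂ := hcs.toSchwartzMap hcd with hq
    have hφ : ((𝓕⁻ q : SchwartzMap (E N) ℂ) : E N → ℂ) = 𝓕⁻ (potentialSymbol n fc) := by
      rw [SchwartzMap.fourierInv_coe]; rfl
    have hφ2 : 𝓕 ((𝓕⁻ q : SchwartzMap (E N) ℂ) : E N → ℂ) = potentialSymbol n fc := by
      rw [← SchwartzMap.fourier_coe, FourierTransform.fourier_fourierInv_eq]; rfl
    have h := hμ (𝓕⁻ q)
    rw [fracLaplacian_apply_of_fourier_eq hfi hφ2] at h
    rw [h]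
    refine norm_signedIntegral_le μ fun x => ?_
    rw [hφ]
    exact hK n x
  -- A subsequence suffices, since the bounds `K n` converge. The decay of order `N + 1` makes a
  -- multiple of the weighted `u` in `hu` the dominating function.
  obtain ⟨s, hs, hae⟩ := exists_subseq_bandPass_tendsto_ae hfi hf0
  obtain ⟨C, hC⟩ := exists_norm_bandPass_le hfi hfA hρ hfs hf0
  have hu1 : AEStronglyMeasurable u := by
    have := hu.1.mul (by fun_prop : Continuous fun x : E N => (1 + ‖x‖) ^ (N + 1)
      ).aestronglyMeasurable
    refine this.congr (ae_of_all _ fun x => ?_)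
    simp only [Pi.mul_apply]
    have : 0 < 1 + ‖x‖ := by positivity
    field_simp
  have hconv : Tendsto (fun i => ∫ x, (u x : ℂ) * bandPass (s i) fc x) atTop
      (𝓝 (∫ x, (u x : ℂ) * fc x)) := by
    refine tendsto_integral_of_dominated_convergence
      (fun x => C * ‖u x / (1 + ‖x‖) ^ (N + 1)‖) (fun i => ?_) (hu.norm.const_mul C)
      (fun i => ae_of_all _ fun x => ?_) ?_
    · exact (Complex.continuous_ofReal.comp_aestronglyMeasurable hu1).mul
        (continuous_bandPass _ hfi).aestronglyMeasurable
    · rw [norm_mul, Complex.norm_real, norm_div, Real.norm_of_nonneg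
        (by positivity : 0 ≤ (1 + ‖x‖) ^ (N + 1)), mul_comm]
      calc _ ≤ C / (1 + ‖x‖) ^ (N + 1) * ‖u x‖ := by gcongr; exact hC _ _
        _ = _ := by ring
    · filter_upwards [hae] with x hx
      exact hx.const_mul _
  have hfin := le_of_tendsto_of_tendsto' hconv.norm
    ((hlim.comp hs.tendsto_atTop).mul_const (μ.totalVariation Set.univ).toReal)
    (fun i => test (s i))
  have e : ∫ x, (u x : ℂ) * fc x = ((∫ x, u x * f x : ℝ) : ℂ) := by
    rw [← integral_complex_ofReal]
    refine integral_congr_ae (ae_of_all _ fun x => ?_)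
    simp [hfc]
  rwa [e, Complex.norm_real, Real.norm_eq_abs] at hfin

/-! ### The Riesz potential of order one and the Riesz multiplier -/

/-- The kernel is not integrable on the whole space; it is used as an integrable part near the
origin plus a part bounded by one. -/
lemma integrable_near_kernel (hN : 2 ≤ N) :
    Integrable ((Metric.ball (0 : E N) 1).indicator fun z => 1 / ‖z‖ ^ ((N : ℝ) - 1)) := by
  rw [integrable_indicator_iff Metric.isOpen_ball.measurableSet]
  refine integrableOn_ball_of_norm_le_rpow (C := 1) (α := (N : ℝ) - 1) ?_ ?_
    (ae_of_all _ fun z => ?_) (by fun_prop : Measurable _).aestronglyMeasurable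
  · rw [finrank_euclideanSpace_fin]; omega
  · rw [finrank_euclideanSpace_fin]; linarith
  · rw [one_mul, one_div, Real.rpow_neg (norm_nonneg z), Real.norm_of_nonneg (by positivity)]

lemma norm_far_kernel_le (hN : 2 ≤ N) (z : E N) :
    ‖((Metric.ball (0 : E N) 1)ᶜ.indicator (fun z => 1 / ‖z‖ ^ ((N : ℝ) - 1))) z‖ ≤ 1 := by
  by_cases hz : z ∈ (Metric.ball (0 : E N) 1)ᶜ
  · rw [Set.indicator_of_mem hz]
    have h1 : 1 ≤ ‖z‖ := by simpa using hz
    have hN' : (2 : ℝ) ≤ N := by exact_mod_cast hN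
    rw [Real.norm_of_nonneg (by positivity)]
    exact div_le_one_of_le₀ (Real.one_le_rpow h1 (by linarith)) (by positivity)
  · rw [Set.indicator_of_notMem hz, norm_zero]; exact zero_le_one

/-- Justifies Fubini. The near part is a convolution integrand times the bounded `η`; the far part
is a bounded factor times the tensor product of `η` and `f`. -/
lemma integrable_prod_mul_kernel (hN : 2 ≤ N) {f η : E N → ℝ} (hf : Integrable f)
    (hη : Integrable η) {B : ℝ} (hB : ∀ x, ‖η x‖ ≤ B) :
    Integrable (fun w : E N × E N => η w.1 * (f w.2 * (1 / ‖w.1 - w.2‖ ^ ((N : ℝ) - 1))))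
      (volume.prod volume) := by
  set S := Metric.ball (0 : E N) 1
  set k : E N → ℝ := fun z => 1 / ‖z‖ ^ ((N : ℝ) - 1) with hk
  have hkm : Measurable k := by fun_prop
  have h1 : Integrable (fun w : E N × E N => f w.2 * (S.indicator k) (w.1 - w.2))
      (volume.prod volume) :=
    hf.convolution_integrand (ContinuousLinearMap.mul ℝ ℝ) (integrable_near_kernel hN)
  have h1' := h1.bdd_mul (c := B) (f := fun w : E N × E N => η w.1) hη.1.comp_fst
    (ae_of_all _ fun w => hB w.1)
  have h2 : Integrable (fun w : E N × E N => η w.1 * f w.2) (volume.prod volume) := hη.mul_prod hf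
  have hm : Measurable (Sᶜ.indicator k) :=
    hkm.indicator Metric.isOpen_ball.measurableSet.compl
  have h2' := h2.bdd_mul (c := 1) (f := fun w : E N × E N => (Sᶜ.indicator k) (w.1 - w.2))
    (hm.comp (measurable_fst.sub measurable_snd)).aestronglyMeasurable
    (ae_of_all _ fun w => norm_far_kernel_le hN _)
  refine (h1'.add h2').congr (ae_of_all _ fun w => ?_)
  have e := congrFun (Set.indicator_self_add_compl S k) (w.1 - w.2)
  simp only [Pi.add_apply] at e ⊢
  rw [show (1 / ‖w.1 - w.2‖ ^ ((N : ℝ) - 1)) = k (w.1 - w.2) from rfl, ← e]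
  ring

lemma ae_integrable_mul_kernel (hN : 2 ≤ N) {f : E N → ℝ} (hf : Integrable f) :
    ∀ᵐ x, Integrable fun y => f y / ‖x - y‖ ^ ((N : ℝ) - 1) := by
  set S := Metric.ball (0 : E N) 1
  set k : E N → ℝ := fun z => 1 / ‖z‖ ^ ((N : ℝ) - 1) with hk
  have hkm : Measurable k := by fun_prop
  have hm : Measurable (Sᶜ.indicator k) :=
    hkm.indicator Metric.isOpen_ball.measurableSet.compl
  filter_upwards [hf.ae_convolution_exists (ContinuousLinearMap.mul ℝ ℝ)
    (integrable_near_kernel hN)] with x hx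
  have h1 : Integrable fun y => f y * (S.indicator k) (x - y) := hx
  have h2 := hf.bdd_mul (c := 1) (f := fun y => (Sᶜ.indicator k) (x - y))
    (hm.comp (by fun_prop)).aestronglyMeasurable (ae_of_all _ fun w => norm_far_kernel_le hN _)
  refine (h1.add h2).congr (ae_of_all _ fun y => ?_)
  have e := congrFun (Set.indicator_self_add_compl S k) (x - y)
  simp only [Pi.add_apply] at e ⊢
  rw [div_eq_mul_one_div, show (1 / ‖x - y‖ ^ ((N : ℝ) - 1)) = k (x - y) from rfl, ← e]
  ring

lemma integrable_bounded_mul_kernel (hN : 2 ≤ N) {η : E N → ℝ}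
    (hη : Integrable η) {B : ℝ} (hB : ∀ x, ‖η x‖ ≤ B) (y : E N) :
    Integrable fun x => η x * (1 / ‖y - x‖ ^ ((N : ℝ) - 1)) := by
  set S := Metric.ball (0 : E N) 1
  set k : E N → ℝ := fun z => 1 / ‖z‖ ^ ((N : ℝ) - 1) with hk
  have hkm : Measurable k := by fun_prop
  have hm : Measurable (Sᶜ.indicator k) :=
    hkm.indicator Metric.isOpen_ball.measurableSet.compl
  have h1 := ((integrable_near_kernel hN).comp_sub_left y).bdd_mul hη.1 (ae_of_all _ hB)
  have h2 := hη.bdd_mul (c := 1) (f := fun x => (Sᶜ.indicator k) (y - x))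
    (hm.comp (by fun_prop)).aestronglyMeasurable (ae_of_all _ fun w => norm_far_kernel_le hN _)
  refine (h1.add h2).congr (ae_of_all _ fun x => ?_)
  have e := congrFun (Set.indicator_self_add_compl S k) (y - x)
  simp only [Pi.add_apply] at e ⊢
  rw [show (1 / ‖y - x‖ ^ ((N : ℝ) - 1)) = k (y - x) from rfl, ← e]
  ring

lemma integral_fourierInv_mul {f g : E N → ℂ} (hf : Integrable f) (hg : Integrable g) :
    ∫ ξ, 𝓕⁻ f ξ * g ξ = ∫ x, f x * 𝓕⁻ g x := by
  have h := integral_fourier_mul hf hg.comp_neg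
  rw [← integral_neg_eq_self (fun ξ => 𝓕 f ξ * g (-ξ))] at h
  simp only [neg_neg, ← Real.fourierInv_eq_fourier_neg] at h
  rw [h, Real.fourierInv_eq_fourier_comp_neg g]

lemma fourierInv_eq_integral (f : E N → ℂ) (x : E N) :
    𝓕⁻ f x = ∫ ξ, f ξ * Complex.exp (2 * Real.pi * Complex.I * (⟪x, ξ⟫ : ℝ)) := by
  rw [Real.fourierInv_eq']
  refine integral_congr_ae (ae_of_all _ fun ξ => ?_)
  simp only [smul_eq_mul, real_inner_comm x ξ]
  push_cast
  rw [mul_comm]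
  congr 2
  ring

/-- Fourier transform of a directional derivative of a test function. -/
lemma fourier_fderiv_apply {φ : E N → ℝ} (hφ : ContDiff ℝ ∞ φ) (hs : HasCompactSupport φ)
    (v ξ : E N) :
    𝓕 (fun x => ((fderiv ℝ φ x v : ℝ) : ℂ)) ξ =
      2 * Real.pi * Complex.I * (⟪v, ξ⟫ : ℝ) * 𝓕 (fun x => (φ x : ℂ)) ξ := by
  have hc : ContDiff ℝ ∞ (fun x => (φ x : ℂ)) := Complex.ofRealCLM.contDiff.comp hφ
  have hcs : HasCompactSupport (fun x => (φ x : ℂ)) :=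
    hs.comp_left (g := fun r : ℝ => (r : ℂ)) Complex.ofReal_zero
  have hi : Integrable (fun x => (φ x : ℂ)) := hc.continuous.integrable_of_hasCompactSupport hcs
  have hi' : Integrable (fderiv ℝ fun x => (φ x : ℂ)) :=
    (hc.continuous_fderiv (by simp)).integrable_of_hasCompactSupport (hcs.fderiv ℝ)
  have h := congrArg (fun L => L v) (congrFun
    (Real.fourier_fderiv hi (hc.differentiable (by simp)) hi') ξ)
  rw [Real.fourier_continuousLinearMap_apply hi'] at h
  have e : (fun x => (fderiv ℝ (fun x => (φ x : ℂ)) x) v) =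
      fun x => ((fderiv ℝ φ x v : ℝ) : ℂ) := by
    ext x
    have := (Complex.ofRealCLM.hasFDerivAt.comp x
      ((hφ.differentiable (by simp)) x).hasFDerivAt).fderiv
    exact congrArg (fun L => L v) this
  rw [e] at h
  rw [h, VectorFourier.fourierSMulRight_apply]
  simp only [neg_apply, Complex.real_smul, smul_eq_mul,
    Complex.ofReal_neg, show (innerSL ℝ) ξ v = ⟪v, ξ⟫ from real_inner_comm v ξ]
  ring

/-- The multiplier `i ⟪v, ξ⟫ / |ξ|` of the Riesz transform in direction `v`. -/
noncomputable def rieszMultiplier (v ξ : E N) : ℂ := Complex.I * (⟪v, ξ⟫ : ℝ) * (1 / ‖ξ‖ : ℝ)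

lemma norm_rieszMultiplier_le (v ξ : E N) : ‖rieszMultiplier v ξ‖ ≤ ‖v‖ := by
  rw [rieszMultiplier, norm_mul, norm_mul, Complex.norm_I, one_mul, Complex.norm_real,
    Complex.norm_real, Real.norm_of_nonneg (by positivity : 0 ≤ 1 / ‖ξ‖), mul_one_div]
  exact div_le_of_le_mul₀ (norm_nonneg _) (norm_nonneg _) (norm_inner_le_norm v ξ)

lemma measurable_rieszMultiplier (v : E N) : Measurable (rieszMultiplier v) := by
  unfold rieszMultiplier; fun_prop

/-- The form of the constant that makes I₁ the multiplier 1/(2π|ξ|) when combined with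
`integral_mul_rieszKernel`. -/
lemma gammaConst_one (N : ℕ) : gammaConst N 1 =
    2 * Real.pi / (Real.pi ^ (-(((N : ℝ) - 1) / 2)) * Real.Gamma (((N : ℝ) - 1) / 2)) := by
  have h : Real.pi ^ ((N : ℝ) / 2) * Real.pi ^ (1 / 2 : ℝ) =
      Real.pi * Real.pi ^ (((N : ℝ) - 1) / 2) := by
    rw [← Real.rpow_add Real.pi_pos, ← Real.rpow_one_add' Real.pi_pos.le]
    · congr 1; ring
    · ring_nf
      positivity
  rw [gammaConst, Real.Gamma_one_half_eq, Real.sqrt_eq_rpow, Real.rpow_one,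
    Real.rpow_neg Real.pi_pos.le, mul_right_comm, h, ← div_div, div_inv_eq_mul]
  ring

lemma integrable_fourier_testFunction {φ : E N → ℝ} (hφ : ContDiff ℝ ∞ φ)
    (hs : HasCompactSupport φ) : Integrable (𝓕 fun x => (φ x : ℂ)) := by
  have hc : ContDiff ℝ ∞ (fun x => (φ x : ℂ)) := Complex.ofRealCLM.contDiff.comp hφ
  have hcs : HasCompactSupport (fun x => (φ x : ℂ)) :=
    hs.comp_left (g := fun r : ℝ => (r : ℂ)) Complex.ofReal_zero
  have := (𝓕 (hcs.toSchwartzMap hc)).integrable (μ := volume)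
  rw [SchwartzMap.fourier_coe] at this
  exact this

/-- The Riesz potential of order one, tested against a directional derivative. -/
lemma integral_rieszPotential_mul_fderiv (hN : 2 ≤ N) {f : E N → ℝ} (hf : Integrable f)
    {φ : E N → ℝ} (hφ : ContDiff ℝ ∞ φ) (hs : HasCompactSupport φ) (v : E N) :
    ((∫ x, rieszPotential 1 f x * fderiv ℝ φ x v : ℝ) : ℂ) =
      ∫ ξ, 𝓕⁻ (fun y => (f y : ℂ)) ξ * (rieszMultiplier v ξ * 𝓕 (fun x => (φ x : ℂ)) ξ) := by
  set η : E N → ℝ := fun x => fderiv ℝ φ x v with hη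
  have hηc : Continuous η := (hφ.continuous_fderiv (by simp)).clm_apply continuous_const
  have hηs : HasCompactSupport η := hs.fderiv_apply ℝ v
  have hηi : Integrable η := hηc.integrable_of_hasCompactSupport hηs
  obtain ⟨B, hB⟩ := hηc.bounded_above_of_compact_support hηs
  have hpos : 0 < Real.pi ^ (-(((N : ℝ) - 1) / 2)) * Real.Gamma (((N : ℝ) - 1) / 2) := by
    have hN' : (2 : ℝ) ≤ N := by exact_mod_cast hN
    exact mul_pos (Real.rpow_pos_of_pos Real.pi_pos _) (Real.Gamma_pos_of_pos (by linarith))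
  set c := Real.pi ^ (-(((N : ℝ) - 1) / 2)) * Real.Gamma (((N : ℝ) - 1) / 2) with hc
  have hFφ := integrable_fourier_testFunction hφ hs
  have hm : Integrable (fun ξ => rieszMultiplier v ξ * 𝓕 (fun x => (φ x : ℂ)) ξ) :=
    hFφ.bdd_mul (measurable_rieszMultiplier v).aestronglyMeasurable
      (ae_of_all _ fun ξ => norm_rieszMultiplier_le v ξ)
  -- The kernel is moved onto the test function: the transform of `f` need not be integrable, while
  -- that of `η` is, and its factor `⟪v, ξ⟫` absorbs the singularity `1 / ‖ξ‖`.
  have hinner : ∀ y, ((∫ x, η x * (1 / ‖y - x‖ ^ ((N : ℝ) - 1)) : ℝ) : ℂ) =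
      ((2 * Real.pi / c : ℝ) : ℂ) *
        𝓕⁻ (fun ξ => rieszMultiplier v ξ * 𝓕 (fun x => (φ x : ℂ)) ξ) y := by
    intro y
    have e : ∀ ξ, 𝓕 (fun x => (η x : ℂ)) ξ * (1 / ‖ξ‖ : ℝ) =
        2 * Real.pi * (rieszMultiplier v ξ * 𝓕 (fun x => (φ x : ℂ)) ξ) := by
      intro ξ
      rw [fourier_fderiv_apply hφ hs v ξ, rieszMultiplier]
      ring
    have key := integral_mul_rieszKernel hN (h := fun x => (η x : ℂ)) hηi.ofReal y
      (by
        refine (integrable_bounded_mul_kernel hN hηi hB y).ofReal.congr (ae_of_all _ fun x => ?_)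
        simp) (by simp_rw [e]; exact hm.const_mul _)
    have e2 : ∫ x, (η x : ℂ) * (1 / ‖y - x‖ ^ ((N : ℝ) - 1) : ℝ) =
        ((∫ x, η x * (1 / ‖y - x‖ ^ ((N : ℝ) - 1)) : ℝ) : ℂ) := by
      rw [← integral_complex_ofReal]
      refine integral_congr_ae (ae_of_all _ fun x => ?_)
      simp only [Complex.ofReal_mul]
    rw [e2] at key
    have hcC : (c : ℂ) ≠ 0 := by exact_mod_cast hpos.ne'
    rw [fourierInv_eq_integral, Complex.ofReal_div, div_mul_eq_mul_div, eq_div_iff hcC, mul_comm,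
      key, ← integral_const_mul]
    refine integral_congr_ae (ae_of_all _ fun ξ => ?_)
    simp only
    rw [mul_right_comm, e]
    push_cast
    ring
  have hprod := integrable_prod_mul_kernel hN hf hηi hB
  have step : ∫ x, rieszPotential 1 f x * η x =
      1 / gammaConst N 1 * ∫ y, f y * ∫ x, η x * (1 / ‖y - x‖ ^ ((N : ℝ) - 1)) := by
    have e1 : ∫ x, rieszPotential 1 f x * η x = 1 / gammaConst N 1 *
        ∫ x, ∫ y, η x * (f y * (1 / ‖x - y‖ ^ ((N : ℝ) - 1))) := by
      rw [← integral_const_mul]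
      refine integral_congr_ae (ae_of_all _ fun x => ?_)
      simp only [rieszPotential]
      rw [integral_const_mul]
      simp only [div_eq_mul_one_div (f _)]
      ring
    rw [e1, integral_integral_swap hprod]
    congr 1
    refine integral_congr_ae (ae_of_all _ fun y => ?_)
    simp only
    rw [← integral_const_mul]
    refine integral_congr_ae (ae_of_all _ fun x => ?_)
    simp only [norm_sub_rev y x]
    ring
  rw [step, integral_fourierInv_mul (f := fun y => (f y : ℂ)) hf.ofReal hm,
    Complex.ofReal_mul, ← integral_complex_ofReal,
    ← integral_const_mul]
  refine integral_congr_ae (ae_of_all _ fun y => ?_)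
  simp only [Complex.ofReal_mul]
  rw [hinner y, gammaConst_one, ← hc]
  have hcC : (c : ℂ) ≠ 0 := by exact_mod_cast hpos.ne'
  have hp : (Real.pi : ℂ) ≠ 0 := by exact_mod_cast Real.pi_ne_zero
  push_cast
  field_simp

lemma HasWeakGradient.integral_mul_fderiv {w : E N → ℝ} {g : E N → E N} (h : HasWeakGradient w g)
    {φ : E N → ℝ} (hφ : ContDiff ℝ ∞ φ) (hs : HasCompactSupport φ) (v : E N) :
    ∫ x, w x * fderiv ℝ φ x v = -∫ x, φ x * ⟪v, g x⟫ := by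
  obtain ⟨hw, hg, hwg⟩ := h
  have hgc : Continuous (gradient φ) :=
    (InnerProductSpace.toDual ℝ (E N)).symm.continuous.comp (hφ.continuous_fderiv (by simp))
  have hgs : HasCompactSupport (gradient φ) :=
    (hs.fderiv ℝ).comp_left (g := (InnerProductSpace.toDual ℝ (E N)).symm) (map_zero _)
  have i1 : Integrable fun x => w x • gradient φ x :=
    hw.integrable_smul_right_of_hasCompactSupport hgc hgs
  have i2 : Integrable fun x => φ x • g x :=
    hg.integrable_smul_left_of_hasCompactSupport hφ.continuous hs
  have h1 := congrArg (fun z => ⟪v, z⟫) (hwg φ hφ hs)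
  simp only [inner_neg_right] at h1
  rw [← integral_inner i1, ← integral_inner i2] at h1
  simpa [real_inner_smul_right] using h1

lemma fourier_comp_sub {φ : E N → ℂ} (a ξ : E N) :
    𝓕 (fun x => φ (x - a)) ξ = Real.fourierChar (-⟪a, ξ⟫) • 𝓕 φ ξ := by
  rw [Real.fourier_eq, Real.fourier_eq,
    ← integral_add_right_eq_self (fun x => Real.fourierChar (-⟪x, ξ⟫) • φ (x - a)) a]
  simp only [add_sub_cancel_right, Circle.smul_def, smul_eq_mul]
  rw [← integral_const_mul]
  refine integral_congr_ae (ae_of_all _ fun x => ?_)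
  simp only [inner_add_left, neg_add, AddChar.map_add_eq_mul, Circle.coe_mul]
  ring

/-- Testing with all translates of `φ` shows that the product of `G` and the transform of `φ` has
vanishing Fourier transform. Inversion at the continuity point makes the product zero there, and it
remains to find `φ` whose transform does not vanish at `ξ`. -/
lemma eq_zero_of_integral_mul_fourier_testFunction {G : E N → ℂ} {B : ℝ}
    (hG : AEStronglyMeasurable G) (hB : ∀ ξ, ‖G ξ‖ ≤ B)
    (h : ∀ φ : E N → ℝ, ContDiff ℝ ∞ φ → HasCompactSupport φ →
      ∫ ξ, G ξ * 𝓕 (fun x => (φ x : ℂ)) ξ = 0)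
    {ξ : E N} (hc : ContinuousAt G ξ) : G ξ = 0 := by
  have point : ∀ φ : E N → ℝ, ContDiff ℝ ∞ φ → HasCompactSupport φ →
      G ξ * 𝓕 (fun x => (φ x : ℂ)) ξ = 0 := by
    intro φ hφ hs
    have hcφ : Continuous fun x => (φ x : ℂ) := Complex.continuous_ofReal.comp hφ.continuous
    have hφi : Integrable (fun x => (φ x : ℂ)) :=
      (hφ.continuous.integrable_of_hasCompactSupport hs).ofReal
    have hi : Integrable (fun ξ => G ξ * 𝓕 (fun x => (φ x : ℂ)) ξ) :=
      (integrable_fourier_testFunction hφ hs).bdd_mul hG (ae_of_all _ hB)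
    have hF : 𝓕 (fun ξ => G ξ * 𝓕 (fun x => (φ x : ℂ)) ξ) = fun _ => 0 := by
      ext a
      have ha := h (fun x => φ (x - a)) (hφ.comp (contDiff_id.sub contDiff_const))
        (hs.comp_homeomorph (Homeomorph.subRight a))
      rw [← ha, Real.fourier_eq]
      refine integral_congr_ae (ae_of_all _ fun ξ => ?_)
      simp only [fourier_comp_sub (φ := fun x => (φ x : ℂ)) a ξ, Circle.smul_def, smul_eq_mul,
        real_inner_comm a ξ]
      ring
    have hinv := hi.fourierInv_fourier_eq (by rw [hF]; exact integrable_zero _ _ _)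
      (hc.mul (continuous_fourier hφi).continuousAt)
    rw [← hinv, hF, Real.fourierInv_eq]
    simp
  -- A bump modulated to frequency `ξ` would do, but test functions are real. Its cosine and sine
  -- parts are used separately; their transforms at `ξ` combine to the positive integral of `b`.
  set b : E N → ℝ := fun x => freqBump N x with hb
  have hbd : ContDiff ℝ ∞ b := (freqBump N).contDiff
  have hbs : HasCompactSupport b := (freqBump N).hasCompactSupport
  have hcos : ContDiff ℝ ∞ fun x : E N => Real.cos (2 * Real.pi * ⟪x, ξ⟫) :=
    Real.contDiff_cos.comp (contDiff_const.mul (contDiff_id.inner ℝ contDiff_const))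
  have hsin : ContDiff ℝ ∞ fun x : E N => Real.sin (2 * Real.pi * ⟪x, ξ⟫) :=
    Real.contDiff_sin.comp (contDiff_const.mul (contDiff_id.inner ℝ contDiff_const))
  have p1 := point _ (hbd.mul hcos) hbs.mul_right
  have p2 := point _ (hbd.mul hsin) hbs.mul_right
  have i1 : Integrable (fun x => ((b x * Real.cos (2 * Real.pi * ⟪x, ξ⟫) : ℝ) : ℂ)) :=
    ((hbd.mul hcos).continuous.integrable_of_hasCompactSupport hbs.mul_right).ofReal
  have i2 : Integrable (fun x => ((b x * Real.sin (2 * Real.pi * ⟪x, ξ⟫) : ℝ) : ℂ)) :=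
    ((hbd.mul hsin).continuous.integrable_of_hasCompactSupport hbs.mul_right).ofReal
  have hsum : 𝓕 (fun x => ((b x * Real.cos (2 * Real.pi * ⟪x, ξ⟫) : ℝ) : ℂ)) ξ +
      Complex.I * 𝓕 (fun x => ((b x * Real.sin (2 * Real.pi * ⟪x, ξ⟫) : ℝ) : ℂ)) ξ =
      ((∫ x, b x : ℝ) : ℂ) := by
    rw [Real.fourier_eq, Real.fourier_eq, ← integral_const_mul, ← integral_complex_ofReal,
      ← integral_add ((Real.fourierIntegral_convergent_iff ξ).2 i1)
        (((Real.fourierIntegral_convergent_iff ξ).2 i2).const_mul _)]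
    refine integral_congr_ae (ae_of_all _ fun x => ?_)
    simp only [Circle.smul_def, smul_eq_mul, Real.fourierChar_apply]
    have e : (((b x * Real.cos (2 * Real.pi * ⟪x, ξ⟫) : ℝ) : ℂ)) +
        Complex.I * ((b x * Real.sin (2 * Real.pi * ⟪x, ξ⟫) : ℝ) : ℂ) =
        b x * Complex.exp (((2 * Real.pi * ⟪x, ξ⟫ : ℝ) : ℂ) * Complex.I) := by
      rw [Complex.exp_mul_I]; push_cast; ring
    calc _ = Complex.exp (((2 * Real.pi * -⟪x, ξ⟫ : ℝ) : ℂ) * Complex.I) *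
          ((((b x * Real.cos (2 * Real.pi * ⟪x, ξ⟫) : ℝ) : ℂ)) +
        Complex.I * ((b x * Real.sin (2 * Real.pi * ⟪x, ξ⟫) : ℝ) : ℂ)) := by ring
      _ = b x * (Complex.exp (((2 * Real.pi * -⟪x, ξ⟫ : ℝ) : ℂ) * Complex.I) *
          Complex.exp (((2 * Real.pi * ⟪x, ξ⟫ : ℝ) : ℂ) * Complex.I)) := by rw [e]; ring
      _ = _ := by
          rw [← Complex.exp_add]
          have : ((2 * Real.pi * -⟪x, ξ⟫ : ℝ) : ℂ) * Complex.I +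
            ((2 * Real.pi * ⟪x, ξ⟫ : ℝ) : ℂ) * Complex.I = 0 := by push_cast; ring
          rw [this, Complex.exp_zero, mul_one]
  have hpos : 0 < ∫ x, b x := (freqBump N).integral_pos
  have hfin : G ξ * ((∫ x, b x : ℝ) : ℂ) = 0 := by
    rw [← hsum, mul_add, p1, zero_add, mul_left_comm, p2, mul_zero]
  exact (mul_eq_zero.1 hfin).resolve_right (by exact_mod_cast hpos.ne')

lemma rieszMultiplier_neg (v ξ : E N) : rieszMultiplier v (-ξ) = -rieszMultiplier v ξ := by
  simp [rieszMultiplier]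

lemma norm_fourier_le (h : E N → ℂ) (ξ : E N) : ‖𝓕 h ξ‖ ≤ ∫ x, ‖h x‖ :=
  VectorFourier.norm_fourierIntegral_le_integral_norm _ _ _ _ _

/-- The Riesz transform acts on the Fourier side by the multiplier `i ξ / |ξ|`. -/
theorem fourier_weakGradient_rieszPotential (hN : 2 ≤ N) {f : E N → ℝ} (hf : Integrable f)
    {g : E N → E N} (hg : Integrable g) (hw : HasWeakGradient (rieszPotential 1 f) g) (v : E N)
    {ξ : E N} (hξ : ξ ≠ 0) :
    𝓕 (fun x => ((⟪v, g x⟫ : ℝ) : ℂ)) ξ =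
      rieszMultiplier v ξ * 𝓕 (fun x => (f x : ℂ)) ξ := by
  have hfi : Integrable (fun x => (f x : ℂ)) := hf.ofReal
  have hgi : Integrable (fun x => ((⟪v, g x⟫ : ℝ) : ℂ)) := (hg.const_inner v).ofReal
  have hcf : Continuous (𝓕⁻ fun x => (f x : ℂ)) := by
    rw [funext (Real.fourierInv_eq_fourier_neg fun x => (f x : ℂ))]
    exact (continuous_fourier hfi).comp continuous_neg
  have hcg : Continuous (𝓕⁻ fun x => ((⟪v, g x⟫ : ℝ) : ℂ)) := by
    rw [funext (Real.fourierInv_eq_fourier_neg fun x => ((⟪v, g x⟫ : ℝ) : ℂ))]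
    exact (continuous_fourier hgi).comp continuous_neg
  set G : E N → ℂ := fun ξ => 𝓕⁻ (fun x => (f x : ℂ)) ξ * rieszMultiplier v ξ +
    𝓕⁻ (fun x => ((⟪v, g x⟫ : ℝ) : ℂ)) ξ with hG
  have hb1 : ∀ ξ, ‖𝓕⁻ (fun x => (f x : ℂ)) ξ * rieszMultiplier v ξ‖ ≤
      (∫ x, ‖(f x : ℂ)‖) * ‖v‖ := fun ξ => by
    rw [norm_mul, Real.fourierInv_eq_fourier_neg]
    gcongr
    · exact norm_fourier_le _ _
    · exact norm_rieszMultiplier_le v ξ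
  -- The multiplication formula produces inverse transforms, hence the reflected frequency. The plus
  -- sign in `G` comes from integration by parts and is undone by the oddness of the multiplier.
  have key : G (-ξ) = 0 := by
    refine eq_zero_of_integral_mul_fourier_testFunction
      (B := (∫ x, ‖(f x : ℂ)‖) * ‖v‖ + ∫ x, ‖((⟪v, g x⟫ : ℝ) : ℂ)‖) ?_ (fun ξ => ?_)
      (fun φ hφ hs => ?_) ?_
    · exact (hcf.aestronglyMeasurable.mul (measurable_rieszMultiplier v).aestronglyMeasurable).add
        hcg.aestronglyMeasurable
    · refine (norm_add_le _ _).trans (add_le_add (hb1 ξ) ?_)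
      rw [Real.fourierInv_eq_fourier_neg]
      exact norm_fourier_le _ _
    · have hFφ := integrable_fourier_testFunction hφ hs
      have h1 := integral_rieszPotential_mul_fderiv hN hf hφ hs v
      rw [hw.integral_mul_fderiv hφ hs v] at h1
      have hφc : Continuous fun x => (φ x : ℂ) := Complex.continuous_ofReal.comp hφ.continuous
      have hφi : Integrable (fun x => (φ x : ℂ)) :=
        (hφ.continuous.integrable_of_hasCompactSupport hs).ofReal
      have h2 := integral_fourierInv_mul hgi hFφ
      rw [Continuous.fourierInv_fourier_eq hφc hφi hFφ] at h2
      have h3 : ∫ x, ((⟪v, g x⟫ : ℝ) : ℂ) * (φ x : ℂ) = ((∫ x, φ x * ⟪v, g x⟫ : ℝ) : ℂ) := by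
        rw [← integral_complex_ofReal]
        refine integral_congr_ae (ae_of_all _ fun x => ?_)
        simp only [Complex.ofReal_mul]; ring
      have i1 : Integrable fun ξ => 𝓕⁻ (fun x => (f x : ℂ)) ξ * rieszMultiplier v ξ *
          𝓕 (fun x => (φ x : ℂ)) ξ :=
        hFφ.bdd_mul (hcf.aestronglyMeasurable.mul
          (measurable_rieszMultiplier v).aestronglyMeasurable) (ae_of_all _ hb1)
      have i2 : Integrable fun ξ => 𝓕⁻ (fun x => ((⟪v, g x⟫ : ℝ) : ℂ)) ξ *
          𝓕 (fun x => (φ x : ℂ)) ξ :=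
        hFφ.bdd_mul hcg.aestronglyMeasurable (ae_of_all _ fun ξ => by
          rw [Real.fourierInv_eq_fourier_neg]; exact norm_fourier_le _ _)
      simp only [hG, add_mul]
      rw [integral_add i1 i2, h2, h3]
      simp_rw [mul_assoc]
      rw [← h1]
      push_cast
      ring
    · refine (hcf.continuousAt.mul ?_).add hcg.continuousAt
      have : -ξ ≠ 0 := neg_ne_zero.2 hξ
      unfold rieszMultiplier
      refine ContinuousAt.mul (by fun_prop) (Complex.continuous_ofReal.continuousAt.comp ?_)
      exact continuousAt_const.div continuous_norm.continuousAt (norm_ne_zero_iff.2 this)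
  simp only [hG, Real.fourierInv_eq_fourier_neg, neg_neg, rieszMultiplier_neg] at key
  linear_combination key

lemma fourier_zero (h : E N → ℂ) : 𝓕 h 0 = ∫ x, h x := by
  rw [Real.fourier_eq]; simp

/-- Elements of the Hardy space, and their Riesz transforms, have mean zero. -/
lemma fourier_zero_eq_zero_of_rieszMultiplier {F G : E N → ℂ} (hF : Continuous F)
    (hG : Continuous G) {v : E N} (hv : v ≠ 0)
    (h : ∀ ξ ≠ 0, G ξ = rieszMultiplier v ξ * F ξ) : F 0 = 0 ∧ G 0 = 0 := by
  have hvn : 0 < ‖v‖ := norm_pos_iff.2 hv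
  -- Along the half-lines spanned by `v` and `-v` the multiplier is constant with opposite nonzero
  -- values. Continuity of `F` and `G` at the origin then forces both to vanish there.
  have lim : ∀ H : E N → ℂ, Continuous H → ∀ σ : ℝ,
      Tendsto (fun s : ℝ => H ((σ * s) • v)) (𝓝[>] 0) (𝓝 (H 0)) := by
    intro H hH σ
    have : Continuous fun s : ℝ => H ((σ * s) • v) := by fun_prop
    have h := this.tendsto 0
    simp only [mul_zero, zero_smul] at h
    exact h.mono_left nhdsWithin_le_nhds
  have val : ∀ s : ℝ, 0 < s → rieszMultiplier v (s • v) = Complex.I * ‖v‖ := by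
    intro s hs
    rw [rieszMultiplier, real_inner_smul_right, real_inner_self_eq_norm_sq, norm_smul,
      Real.norm_of_nonneg hs.le, mul_assoc, ← Complex.ofReal_mul]
    congr 2
    field_simp
  have e1 : G 0 = Complex.I * ‖v‖ * F 0 := by
    refine tendsto_nhds_unique (lim G hG 1) (((lim F hF 1).const_mul (Complex.I * ‖v‖)).congr' ?_)
    filter_upwards [self_mem_nhdsWithin] with s hs
    have hs : 0 < s := hs
    rw [one_mul, h _ (smul_ne_zero hs.ne' hv), val s hs]
  have e2 : G 0 = -(Complex.I * ‖v‖) * F 0 := by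
    refine tendsto_nhds_unique (lim G hG (-1))
      (((lim F hF (-1)).const_mul (-(Complex.I * ‖v‖))).congr' ?_)
    filter_upwards [self_mem_nhdsWithin] with s hs
    have hs : 0 < s := hs
    rw [neg_one_mul, neg_smul, h _ (neg_ne_zero.2 (smul_ne_zero hs.ne' hv)), rieszMultiplier_neg,
      val s hs]
  have hG0 : G 0 = 0 := by linear_combination (e1 + e2) / 2
  refine ⟨?_, hG0⟩
  have hne : Complex.I * (‖v‖ : ℂ) ≠ 0 :=
    mul_ne_zero Complex.I_ne_zero (by exact_mod_cast hvn.ne')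
  rw [hG0] at e1
  exact (mul_eq_zero.1 e1.symm).resolve_left hne

/-! ### The potential in terms of the Riesz transform, with the sharp constant -/

/-- Matches the Gaussian normalisation of the degree-zero kernel with 1/c₀; the factor `N - 1` comes
from the recursion for Γ. -/
lemma gammaConst_sub_one (hN : 2 ≤ N) : ((N : ℝ) - 1) * gammaConst N ((N : ℝ) - 1) =
    (2 * Real.pi) ^ (N : ℝ) *
      (Real.pi ^ (-(((N : ℝ) + 1) / 2)) * Real.Gamma (((N : ℝ) + 1) / 2)) := by
  have hN' : (2 : ℝ) ≤ N := by exact_mod_cast hN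
  have hG : Real.Gamma (((N : ℝ) + 1) / 2) =
      ((N : ℝ) - 1) / 2 * Real.Gamma (((N : ℝ) - 1) / 2) := by
    rw [← Real.Gamma_add_one (by linarith)]
    congr 1; ring
  have h2 : (2 : ℝ) ^ (N : ℝ) = 2 * 2 ^ ((N : ℝ) - 1) := by
    rw [← Real.rpow_one_add' (by norm_num) (by ring_nf; positivity)]
    congr 1; ring
  have hp : Real.pi ^ (N : ℝ) * Real.pi ^ (-(((N : ℝ) + 1) / 2)) * Real.pi ^ (1 / 2 : ℝ) =
      Real.pi ^ ((N : ℝ) / 2) := by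
    rw [← Real.rpow_add Real.pi_pos, ← Real.rpow_add Real.pi_pos]
    congr 1; ring
  have hpi : Real.pi ^ (1 / 2 : ℝ) ≠ 0 := (Real.rpow_pos_of_pos Real.pi_pos _).ne'
  rw [gammaConst, hG, Real.mul_rpow (by norm_num) Real.pi_pos.le, h2, sub_sub_cancel,
    Real.Gamma_one_half_eq, Real.sqrt_eq_rpow, ← hp]
  field_simp

lemma integrable_fourier_mul_bandSymbol_rpow {h : E N → ℂ} (hh : Integrable h) (n : ℕ) :
    Integrable fun ξ => 𝓕 h ξ * bandSymbol N n ξ * (‖ξ‖ ^ (-(N : ℝ)) : ℝ) := by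
  have h1 := (integrable_mul_of_hasCompactSupport (continuous_fourier hh)
    (contDiff_bandSymbol_mul_rpow n (-(N : ℝ))).continuous
    (hasCompactSupport_bandSymbol n).mul_right).const_mul (((2 * Real.pi) ^ (N : ℝ) : ℝ) : ℂ)
  refine h1.congr (ae_of_all _ fun ξ => ?_)
  have e : (2 * Real.pi) ^ (N : ℝ) * (2 * Real.pi * ‖ξ‖) ^ (-(N : ℝ)) = ‖ξ‖ ^ (-(N : ℝ)) := by
    rw [Real.mul_rpow (by positivity) (norm_nonneg _), ← mul_assoc,
      ← Real.rpow_add (by positivity), add_neg_cancel, Real.rpow_zero, one_mul]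
  simp only [← e, Complex.ofReal_mul]
  ring

/-- The band-limited potential of `f` in terms of its Riesz transform `g`. -/
lemma fourierInv_potentialSymbol_eq (hN : 2 ≤ N) {f : E N → ℝ} {g : E N → E N} (hf : Integrable f)
    (hg : Integrable g)
    (hR : ∀ v ξ : E N, ξ ≠ 0 → 𝓕 (fun x => ((⟪v, g x⟫ : ℝ) : ℂ)) ξ =
      rieszMultiplier v ξ * 𝓕 (fun x => (f x : ℂ)) ξ)
    {ι : Type*} [Fintype ι] (b : OrthonormalBasis ι ℝ (E N)) (n : ℕ) (x : E N) :
    (((N : ℝ) - 1) * gammaConst N ((N : ℝ) - 1) : ℝ) *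
      𝓕⁻ (potentialSymbol n fun y => (f y : ℂ)) x =
      -∑ j, ∫ y, bandPass n (fun z => ((⟪b j, g z⟫ : ℝ) : ℂ)) y *
        (⟪b j, y - x⟫ / ‖x - y‖ : ℝ) := by
  have hfi : Integrable (fun x => (f x : ℂ)) := hf.ofReal
  have hgi : ∀ j, Integrable (fun x => ((⟪b j, g x⟫ : ℝ) : ℂ)) :=
    fun j => (hg.const_inner (b j)).ofReal
  set c := Real.pi ^ (-(((N : ℝ) + 1) / 2)) * Real.Gamma (((N : ℝ) + 1) / 2) with hc
  have hterm : ∀ j, ∫ y, bandPass n (fun z => ((⟪b j, g z⟫ : ℝ) : ℂ)) y *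
      (⟪b j, y - x⟫ / ‖x - y‖ : ℝ) =
      (c : ℂ) * ∫ ξ, 𝓕 (fun z => ((⟪b j, g z⟫ : ℝ) : ℂ)) ξ * bandSymbol N n ξ *
        (Complex.I * (⟪b j, ξ⟫ : ℝ) * Complex.exp (2 * Real.pi * Complex.I * (⟪x, ξ⟫ : ℝ)))
        * (‖ξ‖ ^ (-((N : ℝ) + 1)) : ℝ) := by
    intro j
    rw [integral_mul_inner_div_norm (by omega) (integrable_bandPass n (hgi j)) ?_ (b j) x]
    · simp only [fourier_bandPass n (hgi j), ← hc]
    · simp only [fourier_bandPass n (hgi j)]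
      exact integrable_fourier_mul_bandSymbol_rpow (hgi j) n
  -- Applying the Riesz multiplier twice gives `I ^ 2 = -1`. Summed over the basis, the squares of
  -- the coordinates of `ξ` give `‖ξ‖ ^ 2` by Parseval, which recovers `f`.
  have hpt : ∀ j (ξ : E N), ξ ≠ 0 → 𝓕 (fun z => ((⟪b j, g z⟫ : ℝ) : ℂ)) ξ * bandSymbol N n ξ *
        (Complex.I * (⟪b j, ξ⟫ : ℝ) * Complex.exp (2 * Real.pi * Complex.I * (⟪x, ξ⟫ : ℝ)))
        * (‖ξ‖ ^ (-((N : ℝ) + 1)) : ℝ) =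
      -(((⟪ξ, b j⟫ * ⟪b j, ξ⟫ : ℝ) : ℂ) * ((‖ξ‖ ^ 2)⁻¹ : ℝ) *
        (𝓕 (fun y => (f y : ℂ)) ξ * bandSymbol N n ξ * (‖ξ‖ ^ (-(N : ℝ)) : ℝ) *
        Complex.exp (2 * Real.pi * Complex.I * (⟪x, ξ⟫ : ℝ)))) := by
    intro j ξ hξ
    have hpos : 0 < ‖ξ‖ := norm_pos_iff.2 hξ
    have e : ‖ξ‖ ^ (-((N : ℝ) + 1)) * (1 / ‖ξ‖) = ‖ξ‖ ^ (-(N : ℝ)) * (‖ξ‖ ^ 2)⁻¹ := by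
      rw [neg_add, Real.rpow_add hpos, Real.rpow_neg_one]
      field_simp
    rw [hR _ ξ hξ, rieszMultiplier, real_inner_comm ξ (b j)]
    have e' := congrArg (fun r : ℝ => (r : ℂ)) e
    simp only [Complex.ofReal_mul] at e'
    simp only [Complex.ofReal_mul]
    linear_combination (Complex.I ^ 2 * (⟪ξ, b j⟫ : ℝ) ^ 2 * 𝓕 (fun y => (f y : ℂ)) ξ *
      bandSymbol N n ξ * Complex.exp (2 * Real.pi * Complex.I * (⟪x, ξ⟫ : ℝ))) * e' +
      ((⟪ξ, b j⟫ : ℝ) ^ 2 * 𝓕 (fun y => (f y : ℂ)) ξ *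
      bandSymbol N n ξ * Complex.exp (2 * Real.pi * Complex.I * (⟪x, ξ⟫ : ℝ)) *
      (‖ξ‖ ^ (-(N : ℝ)) : ℝ) * ((‖ξ‖ ^ 2)⁻¹ : ℝ)) * Complex.I_sq
  have hint : ∀ j, Integrable fun ξ => 𝓕 (fun z => ((⟪b j, g z⟫ : ℝ) : ℂ)) ξ * bandSymbol N n ξ *
        (Complex.I * (⟪b j, ξ⟫ : ℝ) * Complex.exp (2 * Real.pi * Complex.I * (⟪x, ξ⟫ : ℝ)))
        * (‖ξ‖ ^ (-((N : ℝ) + 1)) : ℝ) := by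
    intro j
    have h1 := (integrable_fourier_mul_bandSymbol_rpow (hgi j) n).bdd_mul (c := ‖b j‖)
      (f := fun ξ => rieszMultiplier (b j) ξ *
        Complex.exp (2 * Real.pi * Complex.I * (⟪x, ξ⟫ : ℝ)))
      ((measurable_rieszMultiplier _).mul (by fun_prop)).aestronglyMeasurable
      (ae_of_all _ fun ξ => by
        rw [norm_mul, norm_expI, mul_one]; exact norm_rieszMultiplier_le _ _)
    refine h1.congr ?_
    filter_upwards [ae_ne (by omega) 0] with ξ hξ
    have hpos : 0 < ‖ξ‖ := norm_pos_iff.2 hξ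
    have e : ‖ξ‖ ^ (-((N : ℝ) + 1)) = ‖ξ‖ ^ (-(N : ℝ)) * (1 / ‖ξ‖) := by
      rw [neg_add, Real.rpow_add hpos, Real.rpow_neg_one, one_div]
    rw [e, rieszMultiplier, Complex.ofReal_mul]
    ring
  simp_rw [hterm]
  rw [← Finset.mul_sum, ← integral_finsetSum _ fun j _ => hint j, gammaConst_sub_one hN, ← hc,
    fourierInv_eq_integral, Complex.ofReal_mul, mul_comm (((2 * Real.pi) ^ (N : ℝ) : ℝ) : ℂ),
    mul_assoc, ← mul_neg, ← integral_neg, ← integral_const_mul]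
  congr 1
  refine integral_congr_ae ?_
  filter_upwards [ae_ne (by omega) 0] with ξ hξ
  have hpos : 0 < ‖ξ‖ := norm_pos_iff.2 hξ
  simp only [hpt _ ξ hξ]
  rw [Finset.sum_neg_distrib, neg_neg, ← Finset.sum_mul, ← Finset.sum_mul, ← Complex.ofReal_sum,
    b.sum_inner_mul_inner, real_inner_self_eq_norm_sq, ← Complex.ofReal_mul,
    mul_inv_cancel₀ (by positivity), Complex.ofReal_one, one_mul, potentialSymbol,
    Real.mul_rpow (by positivity) hpos.le, Complex.ofReal_mul]
  have e : (((2 * Real.pi) ^ (N : ℝ) : ℝ) : ℂ) * (((2 * Real.pi) ^ (-(N : ℝ)) : ℝ) : ℂ) = 1 := by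
    rw [← Complex.ofReal_mul, ← Real.rpow_add (by positivity), add_neg_cancel, Real.rpow_zero,
      Complex.ofReal_one]
  linear_combination (𝓕 (fun y => (f y : ℂ)) ξ * bandSymbol N n ξ * (‖ξ‖ ^ (-(N : ℝ)) : ℝ) *
        Complex.exp (2 * Real.pi * Complex.I * (⟪x, ξ⟫ : ℝ))) * e

lemma abs_inner_div_norm_le {v : E N} (hv : ‖v‖ ≤ 1) (x y : E N) :
    |⟪v, y - x⟫ / ‖x - y‖| ≤ 1 := by
  rw [abs_div, abs_norm]
  refine div_le_one_of_le₀ ?_ (norm_nonneg _)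
  rw [norm_sub_rev x y]
  exact (abs_real_inner_le_norm v _).trans (mul_le_of_le_one_left (norm_nonneg _) hv)

/-- The band-passed components are replaced by those of `g`, at the cost of their L¹ distances. The
sum over `j` then recombines into an inner product of `g y` with a vector of norm at most one;
estimating components separately would lose the sharp constant. -/
lemma norm_fourierInv_potentialSymbol_le (hN : 2 ≤ N) {f : E N → ℝ} {g : E N → E N}
    (hf : Integrable f) (hg : Integrable g)
    (hR : ∀ v ξ : E N, ξ ≠ 0 → 𝓕 (fun x => ((⟪v, g x⟫ : ℝ) : ℂ)) ξ =
      rieszMultiplier v ξ * 𝓕 (fun x => (f x : ℂ)) ξ)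
    {ι : Type*} [Fintype ι] (b : OrthonormalBasis ι ℝ (E N)) (n : ℕ) (x : E N) :
    ‖𝓕⁻ (potentialSymbol n fun y => (f y : ℂ)) x‖ ≤
      1 / (((N : ℝ) - 1) * gammaConst N ((N : ℝ) - 1)) * ((∫ y, ‖g y‖) +
        ∑ j, ∫ y, ‖bandPass n (fun z => ((⟪b j, g z⟫ : ℝ) : ℂ)) y - ((⟪b j, g y⟫ : ℝ) : ℂ)‖) := by
  have hcpos : 0 < ((N : ℝ) - 1) * gammaConst N ((N : ℝ) - 1) := by
    rw [gammaConst_sub_one hN]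
    have := Real.pi_pos
    have : 0 < Real.Gamma (((N : ℝ) + 1) / 2) := Real.Gamma_pos_of_pos (by positivity)
    positivity
  set c := ((N : ℝ) - 1) * gammaConst N ((N : ℝ) - 1) with hc
  have hgi : ∀ j, Integrable (fun x => ((⟪b j, g x⟫ : ℝ) : ℂ)) :=
    fun j => (hg.const_inner (b j)).ofReal
  have h1 := congrArg norm (fourierInv_potentialSymbol_eq hN hf hg hR b n x)
  rw [norm_mul, Complex.norm_real, ← hc, Real.norm_of_nonneg hcpos.le, norm_neg] at h1
  rw [div_mul_eq_mul_div, one_mul, le_div_iff₀ hcpos, mul_comm, h1]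
  set k : ι → E N → ℂ := fun j y => ((⟪b j, y - x⟫ / ‖x - y‖ : ℝ) : ℂ) with hk
  have hkm : ∀ j, AEStronglyMeasurable (k j) := fun j =>
    (by fun_prop : Measurable (k j)).aestronglyMeasurable
  have hk1 : ∀ j y, ‖k j y‖ ≤ 1 := fun j y => by
    rw [hk, Complex.norm_real]
    exact abs_inner_div_norm_le (b.norm_eq_one j).le x y
  have i1 : ∀ j, Integrable fun y => ((⟪b j, g y⟫ : ℝ) : ℂ) * k j y := fun j =>
    (hgi j).mul_bdd (hkm j) (ae_of_all _ (hk1 j))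
  have i2 : ∀ j, Integrable fun y => (bandPass n (fun z => ((⟪b j, g z⟫ : ℝ) : ℂ)) y -
      ((⟪b j, g y⟫ : ℝ) : ℂ)) * k j y := fun j =>
    ((integrable_bandPass n (hgi j)).sub (hgi j)).mul_bdd (hkm j) (ae_of_all _ (hk1 j))
  have split : ∑ j, ∫ y, bandPass n (fun z => ((⟪b j, g z⟫ : ℝ) : ℂ)) y * k j y =
      (∫ y, ∑ j, ((⟪b j, g y⟫ : ℝ) : ℂ) * k j y) +
      ∑ j, ∫ y, (bandPass n (fun z => ((⟪b j, g z⟫ : ℝ) : ℂ)) y -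
        ((⟪b j, g y⟫ : ℝ) : ℂ)) * k j y := by
    rw [integral_finsetSum _ fun j _ => i1 j, ← Finset.sum_add_distrib]
    refine Finset.sum_congr rfl fun j _ => ?_
    rw [← integral_add (i1 j) (i2 j)]
    refine integral_congr_ae (ae_of_all _ fun y => ?_)
    simp only
    ring
  rw [split]
  refine (norm_add_le _ _).trans (add_le_add ?_ ((norm_sum_le _ _).trans
    (Finset.sum_le_sum fun j _ => ?_)))
  · refine norm_integral_le_of_norm_le hg.norm (ae_of_all _ fun y => ?_)
    have e : ∑ j, ((⟪b j, g y⟫ : ℝ) : ℂ) * k j y = ((⟪g y, y - x⟫ / ‖x - y‖ : ℝ) : ℂ) := by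
      rw [← b.sum_inner_mul_inner (g y) (y - x), Finset.sum_div, Complex.ofReal_sum]
      refine Finset.sum_congr rfl fun j _ => ?_
      rw [hk, ← Complex.ofReal_mul, real_inner_comm (b j) (g y), mul_div_assoc]
    rw [e, Complex.norm_real, norm_div, norm_norm]
    refine div_le_of_le_mul₀ (norm_nonneg _) (norm_nonneg _) ?_
    rw [norm_sub_rev x y]
    exact norm_inner_le_norm _ _
  · refine norm_integral_le_of_norm_le ((integrable_bandPass n (hgi j)).sub (hgi j)).norm
      (ae_of_all _ fun y => ?_)
    rw [norm_mul]
    exact mul_le_of_le_one_right (norm_nonneg _) (hk1 j y)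

/-! ### The Hardy space and the duality estimate -/

lemma exists_ne_zero (hN : 2 ≤ N) : ∃ v : E N, v ≠ 0 := by
  have : Nonempty (Fin N) := ⟨⟨0, by omega⟩⟩
  exact _root_.exists_ne 0

lemma MemH1.fourier_eq (hN : 2 ≤ N) {f : E N → ℝ} (hf : MemH1 f) (v ξ : E N) (hξ : ξ ≠ 0) :
    𝓕 (fun x => ((⟪v, rieszTransform f x⟫ : ℝ) : ℂ)) ξ =
      rieszMultiplier v ξ * 𝓕 (fun x => (f x : ℂ)) ξ :=
  fourier_weakGradient_rieszPotential hN hf.1 hf.2.2 hf.2.1 v hξ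

lemma MemH1.integral_eq_zero (hN : 2 ≤ N) {f : E N → ℝ} (hf : MemH1 f) : ∫ x, f x = 0 := by
  obtain ⟨v, hv⟩ := exists_ne_zero hN
  have h := (fourier_zero_eq_zero_of_rieszMultiplier (continuous_fourier hf.1.ofReal)
    (continuous_fourier (hf.2.2.const_inner v).ofReal) hv (hf.fourier_eq hN v)).1
  rw [fourier_zero] at h
  have e : ∫ x, ((f x : ℝ) : ℂ) = ((∫ x, f x : ℝ) : ℂ) := integral_complex_ofReal
  exact_mod_cast e.symm.trans h

lemma MemH1.integral_rieszTransform_eq_zero (hN : 2 ≤ N) {f : E N → ℝ} (hf : MemH1 f) {v : E N}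
    (hv : v ≠ 0) : ∫ x, ((⟪v, rieszTransform f x⟫ : ℝ) : ℂ) = 0 := by
  rw [← fourier_zero]
  exact (fourier_zero_eq_zero_of_rieszMultiplier (continuous_fourier hf.1.ofReal)
    (continuous_fourier (hf.2.2.const_inner v).ofReal) hv (hf.fourier_eq hN v)).2

/-- The sharp duality estimate on bounded compactly supported elements of the Hardy space. -/
theorem MemH1.abs_integral_mul_le (hN : 2 ≤ N) {u : E N → ℝ}
    (hu : Integrable (fun x => u x / (1 + ‖x‖) ^ (N + 1))) {μ : SignedMeasure (E N)}
    (hμ : HasFracLaplacian (N : ℝ) u μ) {f : E N → ℝ} (hf : MemH1 f) (hb : MemLp f (⊤ : ℝ≥0∞))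
    (hs : HasCompactSupport f) :
    |∫ x, u x * f x| ≤ 1 / (((N : ℝ) - 1) * gammaConst N ((N : ℝ) - 1)) *
      (∫ x, ‖rieszTransform f x‖) * (μ.totalVariation Set.univ).toReal := by
  obtain ⟨A, hA⟩ : ∃ A, ∀ᵐ y, ‖f y‖ ≤ A := by
    refine ⟨(eLpNorm f ⊤ volume).toReal, ?_⟩
    rw [eLpNorm_exponent_top]
    have hfin : eLpNormEssSup f volume ≠ ⊤ := by
      rw [← eLpNorm_exponent_top]; exact hb.2.ne
    filter_upwards [enorm_ae_le_eLpNormEssSup f volume] with y hy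
    rw [← toReal_enorm]
    exact ENNReal.toReal_mono hfin hy
  obtain ⟨ρ, hρ⟩ := hs.isCompact.isBounded.subset_closedBall (0 : E N)
  have hsupp : ∀ y, max 1 ρ < ‖y‖ → f y = 0 := by
    intro y hy
    by_contra hne
    have := mem_closedBall_zero_iff.1 (hρ (subset_tsupport f hne))
    exact absurd (this.trans (le_max_right 1 ρ)) (not_le.2 hy)
  set b := EuclideanSpace.basisFun (Fin N) ℝ
  refine abs_integral_mul_le_of_potential_le hu hμ hf.1 hA (le_max_left 1 ρ) hsupp
    (hf.integral_eq_zero hN)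
    (fun n x => norm_fourierInv_potentialSymbol_le hN hf.1 hf.2.2 (hf.fourier_eq hN) b n x) ?_
  refine Tendsto.const_mul _ ?_
  -- The components of the Riesz transform have mean zero too, so the replacement errors vanish and
  -- only the sharp term survives in the limit.
  have h0 : Tendsto (fun n => ∑ j, ∫ y, ‖bandPass n
      (fun z => ((⟪b j, rieszTransform f z⟫ : ℝ) : ℂ)) y -
      ((⟪b j, rieszTransform f y⟫ : ℝ) : ℂ)‖) atTop (𝓝 (∑ _j : Fin N, (0 : ℝ))) :=
    tendsto_finsetSum _ fun j _ => tendsto_integral_norm_bandPass_sub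
      (hf.2.2.const_inner (b j)).ofReal
      (hf.integral_rieszTransform_eq_zero hN (b.orthonormal.ne_zero j))
  simpa using h0.const_add (∫ x, ‖rieszTransform f x‖)

/-- `rieszTransform` is an arbitrary representative, so identities involving it come from uniqueness
of weak gradients up to null sets. -/
lemma HasWeakGradient.ae_eq {w w' : E N → ℝ} {g g' : E N → E N} (h : HasWeakGradient w g)
    (h' : HasWeakGradient w' g') (hw : w =ᵐ[volume] w') : g =ᵐ[volume] g' := by
  refine ae_eq_of_integral_contDiff_smul_eq h.2.1 h'.2.1 fun φ hφ hs => ?_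
  have e : ∫ x, w x • gradient φ x = ∫ x, w' x • gradient φ x := by
    refine integral_congr_ae ?_
    filter_upwards [hw] with x hx
    rw [hx]
  rw [h.2.2 φ hφ hs, h'.2.2 φ hφ hs, neg_inj] at e
  exact e

lemma continuous_gradient {φ : E N → ℝ} (hφ : ContDiff ℝ ∞ φ) : Continuous (gradient φ) :=
  (InnerProductSpace.toDual ℝ (E N)).symm.continuous.comp (hφ.continuous_fderiv (by simp))

lemma hasCompactSupport_gradient {φ : E N → ℝ} (hs : HasCompactSupport φ) :
    HasCompactSupport (gradient φ) :=
  (hs.fderiv ℝ).comp_left (g := (InnerProductSpace.toDual ℝ (E N)).symm) (map_zero _)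

lemma HasWeakGradient.sub {w w' w'' : E N → ℝ} {g g' : E N → E N} (h : HasWeakGradient w g)
    (h' : HasWeakGradient w' g') (hw : w'' =ᵐ[volume] w - w') :
    HasWeakGradient w'' (g - g') := by
  refine ⟨(h.1.sub h'.1).congr hw.symm, h.2.1.sub h'.2.1, fun φ hφ hs => ?_⟩
  have hgc := continuous_gradient hφ
  have hgs := hasCompactSupport_gradient hs
  have e : ∫ x, w'' x • gradient φ x = ∫ x, (w x • gradient φ x - w' x • gradient φ x) := by
    refine integral_congr_ae ?_
    filter_upwards [hw] with x hx
    rw [hx, Pi.sub_apply, sub_smul]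
  rw [e, integral_sub (h.1.integrable_smul_right_of_hasCompactSupport hgc hgs)
    (h'.1.integrable_smul_right_of_hasCompactSupport hgc hgs), h.2.2 φ hφ hs, h'.2.2 φ hφ hs]
  simp only [Pi.sub_apply, smul_sub]
  rw [integral_sub (h.2.1.integrable_smul_left_of_hasCompactSupport hφ.continuous hs)
    (h'.2.1.integrable_smul_left_of_hasCompactSupport hφ.continuous hs)]
  abel

/-- Only almost everywhere: where one of the integrals diverges it takes the default value zero and
linearity may fail. -/
lemma rieszPotential_sub_ae (hN : 2 ≤ N) {f F : E N → ℝ} (hf : Integrable f) (hF : Integrable F) :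
    rieszPotential 1 (fun x => f x - F x) =ᵐ[volume]
      rieszPotential 1 f - rieszPotential 1 F := by
  filter_upwards [ae_integrable_mul_kernel hN hf, ae_integrable_mul_kernel hN hF] with x h1 h2
  simp only [rieszPotential, Pi.sub_apply, sub_div]
  rw [integral_sub h1 h2, mul_sub]

lemma MemH1.sub (hN : 2 ≤ N) {f F : E N → ℝ} (hf : MemH1 f) (hF : MemH1 F) :
    MemH1 (fun x => f x - F x) ∧
      rieszTransform (fun x => f x - F x) =ᵐ[volume] rieszTransform f - rieszTransform F := by
  have hw : HasWeakGradient (rieszPotential 1 fun x => f x - F x)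
      (rieszTransform f - rieszTransform F) :=
    hf.2.1.sub hF.2.1 (rieszPotential_sub_ae hN hf.1 hF.1)
  have hr : HasWeakGradient (rieszPotential 1 fun x => f x - F x)
      (rieszTransform fun x => f x - F x) :=
    Classical.epsilon_spec (p := fun g =>
      HasWeakGradient (rieszPotential 1 fun x => f x - F x) g) ⟨_, hw⟩
  have hae := hr.ae_eq hw (ae_eq_refl _)
  exact ⟨⟨hf.1.sub hF.1, hr, (hf.2.2.sub hF.2.2).congr hae.symm⟩, hae⟩

lemma sqrt_sq_add_norm_sq (a : ℝ) (v : E N) :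
    √(a ^ 2 + ‖v‖ ^ 2) = ‖WithLp.toLp 2 (a, v)‖ := by
  rw [WithLp.prod_norm_eq_of_L2]
  simp

lemma MemH1.integrable_h1Norm {f : E N → ℝ} (hf : MemH1 f) :
    Integrable fun x => √(f x ^ 2 + ‖rieszTransform f x‖ ^ 2) := by
  refine (hf.1.norm.add hf.2.2.norm).mono' ?_ (ae_of_all _ fun x => ?_)
  · exact Real.continuous_sqrt.comp_aestronglyMeasurable
      ((hf.1.1.pow 2).add (hf.2.2.1.norm.pow 2))
  · rw [Real.norm_of_nonneg (Real.sqrt_nonneg _)]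
    refine Real.sqrt_le_iff.2 ⟨add_nonneg (norm_nonneg _) (norm_nonneg _), ?_⟩
    simp only [Pi.add_apply]
    have h1 : f x ^ 2 = ‖f x‖ ^ 2 := by rw [Real.norm_eq_abs, sq_abs]
    rw [h1, add_sq]
    have := mul_nonneg (norm_nonneg (f x)) (norm_nonneg (rieszTransform f x))
    linarith

lemma MemH1.integral_norm_rieszTransform_le {f : E N → ℝ} (hf : MemH1 f) :
    ∫ x, ‖rieszTransform f x‖ ≤ h1Norm f := by
  refine integral_mono hf.2.2.norm hf.integrable_h1Norm fun x => ?_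
  exact Real.le_sqrt_of_sq_le (le_add_of_nonneg_left (sq_nonneg _))

/-- The pointwise triangle inequality in Euclidean ℝ × ℝ^N, for `F = f - (f - F)`. -/
lemma MemH1.h1Norm_le_add (hN : 2 ≤ N) {f F : E N → ℝ} (hf : MemH1 f) (hF : MemH1 F) :
    h1Norm F ≤ h1Norm f + h1Norm (fun x => f x - F x) := by
  obtain ⟨hd, hae⟩ := hf.sub hN hF
  rw [h1Norm, h1Norm, h1Norm, ← integral_add hf.integrable_h1Norm hd.integrable_h1Norm]
  refine integral_mono_ae hF.integrable_h1Norm (hf.integrable_h1Norm.add hd.integrable_h1Norm) ?_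
  filter_upwards [hae] with x hx
  rw [hx, sqrt_sq_add_norm_sq, sqrt_sq_add_norm_sq, sqrt_sq_add_norm_sq]
  have e : WithLp.toLp 2 (F x, rieszTransform F x) = WithLp.toLp 2 (f x, rieszTransform f x) -
      WithLp.toLp 2 (f x - F x, (rieszTransform f - rieszTransform F) x) := by
    rw [← WithLp.toLp_sub]
    simp
  rw [e]
  exact norm_sub_le _ _

lemma normalization_nonneg (hN : 2 ≤ N) :
    0 ≤ 1 / (((N : ℝ) - 1) * gammaConst N ((N : ℝ) - 1)) := by
  rw [gammaConst_sub_one hN]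
  have := Real.pi_pos
  have : 0 < Real.Gamma (((N : ℝ) + 1) / 2) := Real.Gamma_pos_of_pos (by positivity)
  positivity

/-- The sharp estimate holds for the approximants, whose norms are at most one plus a null sequence,
so it passes to the limit defining the pairing. -/
theorem bmoSeminorm_le (hN : 2 ≤ N) {u : E N → ℝ}
    (hu : Integrable (fun x => u x / (1 + ‖x‖) ^ (N + 1))) {μ : SignedMeasure (E N)}
    (hμ : HasFracLaplacian (N : ℝ) u μ) :
    bmoSeminorm u ≤ ENNReal.ofReal (1 / (((N : ℝ) - 1) * gammaConst N ((N : ℝ) - 1))) *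
      μ.totalVariation Set.univ := by
  have hfin : μ.totalVariation Set.univ ≠ ⊤ := by
    rw [SignedMeasure.totalVariation, Measure.add_apply]
    exact ENNReal.add_ne_top.2 ⟨measure_ne_top _ _, measure_ne_top _ _⟩
  have hc := normalization_nonneg hN
  set c := 1 / (((N : ℝ) - 1) * gammaConst N ((N : ℝ) - 1)) with hcdef
  refine iSup_le fun f => iSup_le fun l => iSup_le fun hf => iSup_le fun hf1 => iSup_le fun hp => ?_
  obtain ⟨F, hF, hlim, hint⟩ := hp
  rw [← ENNReal.ofReal_toReal hfin, ← ENNReal.ofReal_mul hc]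
  refine ENNReal.ofReal_le_ofReal ?_
  set M := (μ.totalVariation Set.univ).toReal with hM
  have hM0 : 0 ≤ M := ENNReal.toReal_nonneg
  have hb : ∀ n, ∫ x, u x * F n x ≤ c * (1 + h1Norm fun x => f x - F n x) * M := by
    intro n
    obtain ⟨h1, h2, h3⟩ := hF n
    refine (le_abs_self _).trans ((h1.abs_integral_mul_le hN hu hμ h2 h3).trans ?_)
    gcongr
    refine h1.integral_norm_rieszTransform_le.trans ((hf.h1Norm_le_add hN h1).trans ?_)
    gcongr
  have := le_of_tendsto_of_tendsto' hint
    (((hlim.const_add 1).const_mul c).mul_const M) hb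
  simpa using this

/-! ### Heat evolutions and potentials of mean-zero functions on balls -/

/-- The heat kernel, normalized to have Fourier transform `exp (-π t |ξ|²)`. -/
noncomputable def heatKernel (t : ℝ) (z : E N) : ℂ := (t ^ (-((N : ℝ) / 2)) : ℝ) * modGauss t 0 z

noncomputable def heatSmooth (t : ℝ) (g : E N → ℂ) (z : E N) : ℂ := ∫ y, g y * heatKernel t (z - y)

lemma heatKernel_eq (t : ℝ) (z : E N) :
    heatKernel t z = (t ^ (-((N : ℝ) / 2)) * Real.exp (-(Real.pi * ‖z‖ ^ 2 / t)) : ℝ) := by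
  rw [heatKernel, modGauss_eq, inner_zero_left]
  simp

lemma integrable_heatKernel {t : ℝ} (ht : 0 < t) : Integrable (heatKernel t : E N → ℂ) :=
  (integrable_modGauss ht 0).const_mul _

lemma fourier_heatKernel {t : ℝ} (ht : 0 < t) (ξ : E N) :
    𝓕 (heatKernel t) ξ = (Real.exp (-(Real.pi * ‖ξ‖ ^ 2 * t)) : ℝ) := by
  have h : 𝓕 (heatKernel t) ξ = (t ^ (-((N : ℝ) / 2)) : ℝ) * 𝓕 (modGauss t (0 : E N)) ξ := by
    rw [Real.fourier_eq, Real.fourier_eq, ← integral_const_mul]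
    refine integral_congr_ae (ae_of_all _ fun z => ?_)
    simp only [heatKernel, Circle.smul_def, smul_eq_mul]
    ring
  rw [h, fourier_modGauss ht, ← Complex.ofReal_mul, ← mul_assoc, ← Real.rpow_add ht,
    neg_add_cancel, Real.rpow_zero, one_mul, zero_sub, norm_neg]

lemma integral_norm_heatKernel {t : ℝ} (ht : 0 < t) : ∫ z : E N, ‖heatKernel t z‖ = 1 := by
  have h := fourier_heatKernel (N := N) ht 0
  rw [fourier_zero] at h
  have e : ∫ z : E N, heatKernel t z = ((∫ z : E N, ‖heatKernel t z‖ : ℝ) : ℂ) := by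
    rw [← integral_complex_ofReal]
    refine integral_congr_ae (ae_of_all _ fun z => ?_)
    simp only [heatKernel_eq]
    rw [Complex.norm_real, Real.norm_of_nonneg (by positivity)]
  rw [e] at h
  have h' := Complex.ofReal_injective h
  simpa using h'

lemma integrable_heatSmooth {t : ℝ} (ht : 0 < t) {g : E N → ℂ} (hg : Integrable g) :
    Integrable (heatSmooth t g) :=
  hg.integrable_convolution (ContinuousLinearMap.mul ℂ ℂ) (integrable_heatKernel ht)

lemma fourier_heatSmooth {t : ℝ} (ht : 0 < t) {g : E N → ℂ} (hg : Integrable g) (ξ : E N) :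
    𝓕 (heatSmooth t g) ξ = 𝓕 g ξ * (Real.exp (-(Real.pi * ‖ξ‖ ^ 2 * t)) : ℝ) := by
  have h := Real.fourier_mul_convolution_eq hg (integrable_heatKernel (N := N) ht) ξ
  rw [fourier_heatKernel ht] at h
  exact h

lemma norm_heatSmooth_le {t : ℝ} (ht : 0 < t) {g : E N → ℂ} {A : ℝ}
    (hA : ∀ᵐ y, ‖g y‖ ≤ A) (z : E N) : ‖heatSmooth t g z‖ ≤ A := by
  have hi := ((integrable_heatKernel (N := N) ht).comp_sub_left z).norm
  have h : ‖heatSmooth t g z‖ ≤ ∫ y, A * ‖heatKernel t (z - y)‖ := by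
    refine norm_integral_le_of_norm_le (hi.const_mul A) ?_
    filter_upwards [hA] with y hy
    rw [norm_mul]
    gcongr
  rw [integral_const_mul, integral_sub_left_eq_self (fun y => ‖heatKernel t y‖) volume z,
    integral_norm_heatKernel ht, mul_one] at h
  exact h

/-- The derivative is at most one in modulus because `2 * |s| ≤ 1 + s ^ 2 ≤ exp (s ^ 2)`. -/
lemma abs_exp_neg_sq_sub_le (a b : ℝ) :
    |Real.exp (-a ^ 2) - Real.exp (-b ^ 2)| ≤ |a - b| := by
  have hd : ∀ s : ℝ, HasDerivAt (fun s => Real.exp (-s ^ 2)) (Real.exp (-s ^ 2) * (-(2 * s))) s := by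
    intro s
    have := ((hasDerivAt_pow 2 s).neg).exp
    simpa using this
  have h := convex_univ.norm_image_sub_le_of_norm_hasDerivWithin_le (C := 1)
    (fun s _ => (hd s).hasDerivWithinAt) (fun s _ => ?_) (Set.mem_univ b) (Set.mem_univ a)
  · simpa using h
  · rw [norm_mul, Real.norm_of_nonneg (Real.exp_nonneg _), Real.exp_neg, inv_mul_le_iff₀
      (Real.exp_pos _), mul_one, norm_neg, Real.norm_eq_abs, abs_mul, abs_two]
    have := Real.add_one_le_exp (s ^ 2)
    nlinarith [sq_nonneg (|s| - 1), sq_abs s]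

/-- Subtracting the kernel's value at the centre gains a factor of order `r / √t` over the trivial
bound, which is what makes the integral over large times converge. -/
lemma norm_heatSmooth_le_of_mean_zero {t : ℝ} (ht : 0 < t) {g : E N → ℂ} (hg : Integrable g)
    {x₀ : E N} {r : ℝ} (hsupp : ∀ y, y ∉ Metric.ball x₀ r → g y = 0) (h0 : ∫ y, g y = 0)
    (z : E N) :
    ‖heatSmooth t g z‖ ≤ t ^ (-((N : ℝ) / 2)) * ((∫ y, ‖g y‖) * (√(Real.pi / t) * r)) := by
  set k : E N → ℂ := fun y => (Real.exp (-(Real.pi * ‖z - y‖ ^ 2 / t)) : ℝ) with hk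
  have hkc : Continuous k := by
    refine Complex.continuous_ofReal.comp (Real.continuous_exp.comp ?_)
    fun_prop
  have hk1 : ∀ y, ‖k y‖ ≤ 1 := fun y => by
    rw [hk, Complex.norm_real, Real.norm_of_nonneg (Real.exp_nonneg _)]
    exact Real.exp_le_one_iff.2 (neg_nonpos.2 (by have := Real.pi_pos; positivity))
  have e : heatSmooth t g z =
      (t ^ (-((N : ℝ) / 2)) : ℝ) * ∫ y, g y * (k y - k x₀) := by
    have h1 : ∫ y, g y * (k y - k x₀) = ∫ y, g y * k y := by
      simp_rw [mul_sub]
      rw [integral_sub (hg.mul_bdd hkc.aestronglyMeasurable (ae_of_all _ hk1)) (hg.mul_const _),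
        integral_mul_const, h0, zero_mul, sub_zero]
    rw [h1, ← integral_const_mul]
    refine integral_congr_ae (ae_of_all _ fun y => ?_)
    simp only [heatKernel_eq, Complex.ofReal_mul, hk]
    ring
  have hs : ∀ a : ℝ, Real.pi * a ^ 2 / t = (√(Real.pi / t) * a) ^ 2 := fun a => by
    rw [mul_pow, Real.sq_sqrt (div_nonneg Real.pi_pos.le ht.le)]; ring
  rw [e, norm_mul, Complex.norm_real, Real.norm_of_nonneg (by positivity), ← integral_mul_const]
  gcongr
  refine norm_integral_le_of_norm_le (hg.norm.mul_const _) (ae_of_all _ fun y => ?_)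
  rw [norm_mul]
  by_cases hy : y ∈ Metric.ball x₀ r
  · gcongr
    rw [hk, ← Complex.ofReal_sub, Complex.norm_real, hs, hs, Real.norm_eq_abs]
    refine (abs_exp_neg_sq_sub_le _ _).trans ?_
    rw [← mul_sub, abs_mul, abs_of_nonneg (Real.sqrt_nonneg _)]
    gcongr
    refine (abs_norm_sub_norm_le _ _).trans ?_
    rw [sub_sub_sub_cancel_left, ← dist_eq_norm, dist_comm]
    exact (Metric.mem_ball.1 hy).le
  · simp [hsupp y hy]

lemma integral_norm_dilate {a : ℝ} (ha : 0 < a) :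
    ∫ z, ‖dilate N a z‖ = ∫ z, ‖window N z‖ := by
  have h2 := Measure.integral_comp_smul (volume : Measure (E N)) (fun z => ‖window N z‖) a
  simp only [finrank_euclideanSpace_fin] at h2
  simp only [dilate, norm_mul, Complex.norm_real]
  rw [integral_const_mul, h2, abs_of_pos (by positivity), Real.norm_of_nonneg (by positivity),
    smul_eq_mul, ← mul_assoc, mul_inv_cancel₀ (by positivity), one_mul]

lemma norm_bandPass_le_of_norm_le (n : ℕ) {h : E N → ℂ} {D : ℝ} (hD : ∀ y, ‖h y‖ ≤ D) (x : E N) :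
    ‖bandPass n h x‖ ≤ D * (2 * ∫ z, ‖window N z‖) := by
  have hi := (integrable_bandKernel (N := N) n).norm
  have hn : (0 : ℝ) < n + 1 := by positivity
  have hD0 : 0 ≤ D := (norm_nonneg _).trans (hD 0)
  have h1 : ‖bandPass n h x‖ ≤ ∫ y, D * ‖bandKernel N n (x - y)‖ := by
    refine norm_integral_le_of_norm_le ((hi.comp_sub_left x).const_mul D) (ae_of_all _ fun y => ?_)
    rw [norm_mul]
    gcongr
    exact hD y
  rw [integral_const_mul, integral_sub_left_eq_self (fun y => ‖bandKernel N n y‖) volume x] at h1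
  refine h1.trans ?_
  gcongr
  have i1 := (integrable_dilate (N := N) hn).norm
  have i2 := (integrable_dilate (N := N) (inv_pos.2 hn)).norm
  calc ∫ y, ‖bandKernel N n y‖
      ≤ ∫ y, (‖dilate N (n + 1) y‖ + ‖dilate N ((n + 1 : ℝ)⁻¹) y‖) :=
        integral_mono hi (i1.add i2) fun y => norm_sub_le _ _
    _ = _ := by
        rw [integral_add i1 i2, integral_norm_dilate hn, integral_norm_dilate (inv_pos.2 hn),
          two_mul]

/-- The band-limited potential as a superposition of heat evolutions. -/
lemma fourierInv_potentialSymbol_eq_integral_heat (hN : 2 ≤ N) {g : E N → ℂ} (hg : Integrable g)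
    (n : ℕ) (x : E N) :
    ((2 * Real.pi) ^ (N : ℝ) * (Real.pi ^ (-((N : ℝ) / 2)) * Real.Gamma ((N : ℝ) / 2)) : ℝ) *
      𝓕⁻ (potentialSymbol n g) x =
      ∫ t in Set.Ioi (0 : ℝ), ((t ^ ((N : ℝ) / 2 - 1) : ℝ) : ℂ) * bandPass n (heatSmooth t g) x := by
  have hs : (0 : ℝ) < (N : ℝ) / 2 := by
    have hN' : (2 : ℝ) ≤ N := by exact_mod_cast hN
    linarith
  set G := Real.Gamma ((N : ℝ) / 2) with hG
  set P := Real.pi ^ (-((N : ℝ) / 2)) with hP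
  have hFc := continuous_fourier hg
  have hbc := (contDiff_bandSymbol (N := N) n).continuous
  have key := integral_superposition (μ := (volume : Measure (E N)))
    (A := fun ξ => 𝓕 g ξ * bandSymbol N n ξ *
      Complex.exp (2 * Real.pi * Complex.I * (⟪x, ξ⟫ : ℝ)))
    (e := fun t ξ => t ^ ((N : ℝ) / 2 - 1) * Real.exp (-((Real.pi * ‖ξ‖ ^ 2) * t)))
    (κ := fun ξ => P * G * ‖ξ‖ ^ (-(N : ℝ)))
    ((hFc.mul hbc).mul (by fun_prop)).aestronglyMeasurable
    (by fun_prop) (fun t ht y => by positivity)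
    (by
      filter_upwards [ae_ne (by omega) 0] with ξ hξ
      have hpos : 0 < ‖ξ‖ := norm_pos_iff.2 hξ
      have := integral_rpow_mul_exp_neg_mul (a := Real.pi * ‖ξ‖ ^ 2) hs (by positivity)
      refine ⟨this.1, this.2.trans ?_⟩
      rw [one_div_mul_sq_rpow hpos.le, mul_right_comm]
      congr 3
      ring)
    (by
      have h1 := ((integrable_fourier_mul_bandSymbol_rpow hg n).const_mul ((P * G : ℝ) : ℂ)).bdd_mul
        (c := 1) (f := fun ξ => Complex.exp (2 * Real.pi * Complex.I * (⟪x, ξ⟫ : ℝ)))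
        (by fun_prop : Continuous _).aestronglyMeasurable
        (ae_of_all _ fun ξ => (norm_expI _).le)
      refine h1.congr (ae_of_all _ fun ξ => ?_)
      simp only [Complex.ofReal_mul]
      ring)
  have hl : ∫ t in Set.Ioi (0 : ℝ), ((t ^ ((N : ℝ) / 2 - 1) : ℝ) : ℂ) *
      bandPass n (heatSmooth t g) x = ∫ t in Set.Ioi (0 : ℝ), ∫ ξ, 𝓕 g ξ * bandSymbol N n ξ *
      Complex.exp (2 * Real.pi * Complex.I * (⟪x, ξ⟫ : ℝ)) *
      ((t ^ ((N : ℝ) / 2 - 1) * Real.exp (-((Real.pi * ‖ξ‖ ^ 2) * t)) : ℝ) : ℂ) := by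
    refine setIntegral_congr_fun measurableSet_Ioi fun t ht => ?_
    have ht : 0 < t := ht
    rw [bandPass_eq_fourierInv n (integrable_heatSmooth ht hg), fourierInv_eq_integral,
      ← integral_const_mul]
    refine integral_congr_ae (ae_of_all _ fun ξ => ?_)
    simp only [fourier_heatSmooth ht hg, Complex.ofReal_mul]
    ring
  rw [hl, key, fourierInv_eq_integral, ← integral_const_mul]
  refine integral_congr_ae (ae_of_all _ fun ξ => ?_)
  have e : ((2 * Real.pi) ^ (N : ℝ) : ℝ) * (2 * Real.pi * ‖ξ‖) ^ (-(N : ℝ)) =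
      ‖ξ‖ ^ (-(N : ℝ)) := by
    rw [Real.mul_rpow (by positivity) (norm_nonneg _), ← mul_assoc,
      ← Real.rpow_add (by positivity), add_neg_cancel, Real.rpow_zero, one_mul]
  simp only [potentialSymbol, ← e, Complex.ofReal_mul]
  ring

/-- Uniform bound for the potentials of bounded mean-zero functions supported in a ball. -/
theorem exists_norm_fourierInv_potentialSymbol_le (hN : 2 ≤ N) :
    ∃ C : ℝ, 0 ≤ C ∧ ∀ (x₀ : E N) (r : ℝ), 0 < r → ∀ (g : E N → ℂ) (A : ℝ), Integrable g →
      (∀ᵐ y, ‖g y‖ ≤ A) → (∀ y, y ∉ Metric.ball x₀ r → g y = 0) → ∫ y, g y = 0 →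
      ∀ n x, ‖𝓕⁻ (potentialSymbol n g) x‖ ≤ C * (A * r ^ N + ∫ y, ‖g y‖) := by
  have hN' : (2 : ℝ) ≤ N := by exact_mod_cast hN
  have hs : (0 : ℝ) < (N : ℝ) / 2 := by linarith
  have hGpos : 0 < Real.Gamma ((N : ℝ) / 2) := Real.Gamma_pos_of_pos hs
  have hcpos : 0 < (2 * Real.pi) ^ (N : ℝ) *
      (Real.pi ^ (-((N : ℝ) / 2)) * Real.Gamma ((N : ℝ) / 2)) := by
    have := Real.pi_pos
    positivity
  set c := (2 * Real.pi) ^ (N : ℝ) * (Real.pi ^ (-((N : ℝ) / 2)) * Real.Gamma ((N : ℝ) / 2))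
    with hc
  set W := 2 * ∫ z, ‖window N z‖ with hW
  have hW0 : 0 ≤ W := mul_nonneg zero_le_two (integral_nonneg fun z => norm_nonneg _)
  refine ⟨(2 * √Real.pi + 1) * W / c, by positivity, ?_⟩
  intro x₀ r hr g A hg hA hsupp h0 n x
  have hA0 : 0 ≤ A := by
    obtain ⟨y, hy⟩ := hA.exists
    exact (norm_nonneg _).trans hy
  set M := ∫ y, ‖g y‖ with hM
  have hM0 : 0 ≤ M := integral_nonneg fun y => norm_nonneg _
  have hr2 : 0 < r ^ 2 := by positivity
  -- For times up to r² the heat evolution is bounded by `A`; the integral carries a factor `2 / N`,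
  -- at most one.
  have near : IntegrableOn (fun t : ℝ => A * W * t ^ ((N : ℝ) / 2 - 1)) (Set.Ioc 0 (r ^ 2)) ∧
      ∫ t in Set.Ioc (0 : ℝ) (r ^ 2), A * W * t ^ ((N : ℝ) / 2 - 1) ≤ A * W * r ^ N := by
    have hi : IntervalIntegrable (fun t : ℝ => t ^ ((N : ℝ) / 2 - 1)) volume 0 (r ^ 2) :=
      intervalIntegral.intervalIntegrable_rpow' (by linarith)
    refine ⟨((intervalIntegrable_iff_integrableOn_Ioc_of_le hr2.le).1 hi).const_mul _, ?_⟩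
    rw [integral_const_mul, ← intervalIntegral.integral_of_le hr2.le,
      integral_rpow (Or.inl (by linarith)), sub_add_cancel, Real.zero_rpow hs.ne', sub_zero]
    gcongr
    have e : (r ^ 2) ^ ((N : ℝ) / 2) = r ^ N := by
      rw [← Real.rpow_natCast r 2, ← Real.rpow_mul hr.le, ← Real.rpow_natCast r N]
      congr 1; push_cast; ring
    rw [e]
    exact div_le_self (by positivity) (by linarith)
  -- For later times the powers of `t`, including the cancellation gain, combine to `t ^ (-3 / 2)`.
  -- Its integral beyond r² is `2 / r`, which cancels the factor `r`.
  have far : IntegrableOn (fun t : ℝ => M * √Real.pi * r * W * t ^ (-(3 / 2) : ℝ))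
      (Set.Ioi (r ^ 2)) ∧
      ∫ t in Set.Ioi (r ^ 2), M * √Real.pi * r * W * t ^ (-(3 / 2) : ℝ) = M * √Real.pi * W * 2 := by
    refine ⟨(integrableOn_Ioi_rpow_of_lt (by norm_num) hr2).const_mul _, ?_⟩
    rw [integral_const_mul, integral_Ioi_rpow_of_lt (by norm_num) hr2]
    have e : (r ^ 2) ^ (-(3 / 2) + 1 : ℝ) = r⁻¹ := by
      rw [← Real.rpow_natCast r 2, ← Real.rpow_mul hr.le, ← Real.rpow_neg_one]
      congr 1; norm_num
    rw [e]
    field_simp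
    norm_num
  have pt : ∀ t : ℝ, 0 < t → ∀ D, (∀ z, ‖heatSmooth t g z‖ ≤ D) →
      ‖((t ^ ((N : ℝ) / 2 - 1) : ℝ) : ℂ) * bandPass n (heatSmooth t g) x‖ ≤
        t ^ ((N : ℝ) / 2 - 1) * (D * W) := by
    intro t ht D hD
    rw [norm_mul, Complex.norm_real, Real.norm_of_nonneg (by positivity)]
    gcongr
    exact norm_bandPass_le_of_norm_le n hD x
  have b1 : ‖∫ t in Set.Ioc (0 : ℝ) (r ^ 2), ((t ^ ((N : ℝ) / 2 - 1) : ℝ) : ℂ) *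
      bandPass n (heatSmooth t g) x‖ ≤ A * W * r ^ N := by
    refine (norm_integral_le_of_norm_le near.1 ?_).trans near.2
    filter_upwards [ae_restrict_mem measurableSet_Ioc] with t ht
    refine (pt t ht.1 A (norm_heatSmooth_le ht.1 hA)).trans_eq ?_
    ring
  have b2 : ‖∫ t in Set.Ioi (r ^ 2), ((t ^ ((N : ℝ) / 2 - 1) : ℝ) : ℂ) *
      bandPass n (heatSmooth t g) x‖ ≤ M * √Real.pi * W * 2 := by
    refine (norm_integral_le_of_norm_le far.1 ?_).trans far.2.le
    filter_upwards [ae_restrict_mem measurableSet_Ioi] with t ht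
    have ht0 : 0 < t := hr2.trans ht
    refine (pt t ht0 _ (norm_heatSmooth_le_of_mean_zero ht0 hg hsupp h0)).trans_eq ?_
    have e : t ^ ((N : ℝ) / 2 - 1) * t ^ (-((N : ℝ) / 2)) * t ^ (-(1 / 2) : ℝ) =
        t ^ (-(3 / 2) : ℝ) := by
      rw [← Real.rpow_add ht0, ← Real.rpow_add ht0]
      congr 1; ring
    rw [Real.sqrt_div Real.pi_pos.le, ← e, Real.rpow_neg ht0.le (1 / 2), ← Real.sqrt_eq_rpow]
    ring
  have hb : ‖∫ t in Set.Ioi (0 : ℝ), ((t ^ ((N : ℝ) / 2 - 1) : ℝ) : ℂ) *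
      bandPass n (heatSmooth t g) x‖ ≤ A * W * r ^ N + M * √Real.pi * W * 2 := by
    -- Integrability over all times need not be shown: if it fails, the integral is zero by
    -- convention and the bound is trivial.
    by_cases hint : IntegrableOn (fun t : ℝ => ((t ^ ((N : ℝ) / 2 - 1) : ℝ) : ℂ) *
      bandPass n (heatSmooth t g) x) (Set.Ioi 0)
    · rw [← Set.Ioc_union_Ioi_eq_Ioi hr2.le, setIntegral_union (Set.Ioc_disjoint_Ioi le_rfl)
        measurableSet_Ioi (hint.mono_set Set.Ioc_subset_Ioi_self)
        (hint.mono_set (Set.Ioi_subset_Ioi hr2.le))]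
      exact (norm_add_le _ _).trans (add_le_add b1 b2)
    · rw [integral_undef hint, norm_zero]; positivity
  rw [← fourierInv_potentialSymbol_eq_integral_heat hN hg n x, norm_mul, Complex.norm_real, ← hc,
    Real.norm_of_nonneg hcpos.le] at hb
  rw [div_mul_eq_mul_div, le_div_iff₀ hcpos, mul_comm]
  refine hb.trans ?_
  have hp := Real.sqrt_nonneg Real.pi
  have : 0 ≤ 2 * √Real.pi * W * (A * r ^ N) + W * M := by positivity
  linarith

/-! ### Bounded mean oscillation -/

lemma locallyIntegrable_of_weighted {u : E N → ℝ}
    (hu : Integrable (fun x => u x / (1 + ‖x‖) ^ (N + 1))) : LocallyIntegrable u := by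
  have h := hu.locallyIntegrable.continuous_mul
    (by fun_prop : Continuous fun x : E N => (1 + ‖x‖) ^ (N + 1))
  refine h.congr (ae_of_all _ fun x => ?_)
  have : (0 : ℝ) < 1 + ‖x‖ := by positivity
  beta_reduce
  field_simp

/-- Mean oscillation is computed by testing against a bounded mean-zero function. -/
lemma exists_test_of_oscillation {X : Type*} [MeasurableSpace X] {ν : Measure X} {S : Set X}
    (hS : MeasurableSet S) (hS0 : ν S ≠ 0) (hSt : ν S ≠ ⊤) {u : X → ℝ} (hu : IntegrableOn u S ν)
    (hum : AEStronglyMeasurable u ν) :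
    ∃ g : X → ℝ, Integrable g ν ∧ (∀ y, ‖g y‖ ≤ 2) ∧ (∀ y, y ∉ S → g y = 0) ∧ ∫ y, g y ∂ν = 0 ∧
      ∫ y in S, |u y - ⨍ z in S, u z ∂ν| ∂ν = ∫ y, u y * g y ∂ν := by
  set m := ⨍ z in S, u z ∂ν with hm
  set V := ν.real S with hV
  have hVpos : 0 < V := ENNReal.toReal_pos hS0 hSt
  have hfin : IsFiniteMeasure (ν.restrict S) := ⟨by simpa using hSt.lt_top⟩
  -- The test function is the sign of `u - m` on `S`, minus its mean `a` there. Moving the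
  -- correction onto `u` gives ∫ u (s - a) = ∫ (u - m) s = ∫ |u - m| over `S`.
  set s : X → ℝ := fun y => if m ≤ u y then 1 else -1 with hs
  have hsm : AEStronglyMeasurable s ν :=
    ((Measurable.ite measurableSet_Ici measurable_const measurable_const :
      Measurable fun t : ℝ => if m ≤ t then (1 : ℝ) else -1).comp_aemeasurable
      hum.aemeasurable).aestronglyMeasurable
  have hs1 : ∀ y, ‖s y‖ ≤ 1 := fun y => by
    simp only [hs]; split_ifs <;> simp
  have hsi : IntegrableOn s S ν := Integrable.of_bound hsm.restrict 1 (ae_of_all _ hs1)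
  have hsu : IntegrableOn (fun y => u y * s y) S ν :=
    hu.mul_bdd hsm.restrict (ae_of_all _ hs1)
  set a := ⨍ z in S, s z ∂ν with ha
  have haV : ∫ y in S, s y ∂ν = a * V := by
    rw [ha, setAverage_eq, smul_eq_mul, ← hV, mul_comm, mul_inv_cancel_left₀ hVpos.ne']
  have hmV : ∫ y in S, u y ∂ν = m * V := by
    rw [hm, setAverage_eq, smul_eq_mul, ← hV, mul_comm, mul_inv_cancel_left₀ hVpos.ne']
  have ha1 : ‖a‖ ≤ 1 := by
    have h := norm_integral_le_of_norm_le_const (μ := ν.restrict S) (f := s) (ae_of_all _ hs1)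
    rw [haV, norm_mul, Real.norm_of_nonneg hVpos.le, one_mul, measureReal_restrict_apply_univ] at h
    exact le_of_mul_le_mul_right (by rwa [one_mul]) hVpos
  have hconst : ∀ c : ℝ, ∫ _ in S, c ∂ν = c * V := fun c => by
    rw [setIntegral_const, smul_eq_mul, mul_comm]
  refine ⟨S.indicator fun y => s y - a, ?_, fun y => ?_, fun y hy => Set.indicator_of_notMem hy _,
    ?_, ?_⟩
  · exact (integrable_indicator_iff hS).2 (hsi.sub (integrable_const a))
  · refine (norm_indicator_le_norm_self _ _).trans ((norm_sub_le _ _).trans ?_)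
    linarith [hs1 y]
  · rw [integral_indicator hS, integral_sub hsi (integrable_const a), haV, hconst, sub_self]
  · have e1 : ∀ y, u y * S.indicator (fun y => s y - a) y =
        S.indicator (fun y => u y * s y - u y * a) y := fun y => by
      by_cases hy : y ∈ S
      · simp [hy, mul_sub]
      · simp [hy]
    have e2 : ∀ y, |u y - m| = u y * s y - m * s y := fun y => by
      simp only [hs]
      split_ifs with h
      · rw [abs_of_nonneg (sub_nonneg.2 h)]; ring
      · rw [abs_of_neg (sub_neg.2 (not_le.1 h))]; ring
    simp_rw [e1, e2]
    rw [integral_indicator hS, integral_sub hsu (hsi.const_mul m),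
      integral_sub hsu (hu.mul_const a), integral_const_mul, integral_mul_const, haV, hmV]
    ring

/-- The test function is at most 2 in absolute value and its L¹ norm is at most twice the volume of
the ball. Both terms of the potential bound therefore scale like `r ^ N`, and division by the volume
leaves a constant independent of the ball. -/
theorem memBMO (hN : 2 ≤ N) {u : E N → ℝ}
    (hu : Integrable (fun x => u x / (1 + ‖x‖) ^ (N + 1))) {μ : SignedMeasure (E N)}
    (hμ : HasFracLaplacian (N : ℝ) u μ) : MemBMO u := by
  have hloc := locallyIntegrable_of_weighted hu
  obtain ⟨C, hC0, hC⟩ := exists_norm_fourierInv_potentialSymbol_le hN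
  set T := (μ.totalVariation Set.univ).toReal with hT
  have hT0 : 0 ≤ T := ENNReal.toReal_nonneg
  set V₁ := volume.real (Metric.ball (0 : E N) 1) with hV₁
  have hV₁pos : 0 < V₁ :=
    ENNReal.toReal_pos (Metric.measure_ball_pos _ _ one_pos).ne' measure_ball_lt_top.ne
  refine ⟨hloc, C * (2 / V₁ + 2) * T, fun x₀ r hr => ?_⟩
  have hVpos : 0 < volume.real (Metric.ball x₀ r) :=
    ENNReal.toReal_pos (Metric.measure_ball_pos _ _ hr).ne' measure_ball_lt_top.ne
  have hVr : volume.real (Metric.ball x₀ r) = r ^ N * V₁ := by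
    rw [Measure.real, Measure.addHaar_ball_of_pos _ _ hr, ENNReal.toReal_mul,
      ENNReal.toReal_ofReal (by positivity), finrank_euclideanSpace_fin]
    rfl
  have hub : IntegrableOn u (Metric.ball x₀ r) :=
    (hloc.integrableOn_isCompact (isCompact_closedBall x₀ r)).mono_set Metric.ball_subset_closedBall
  obtain ⟨g, hgi, hg2, hgs, hg0, hosc⟩ := exists_test_of_oscillation
    Metric.isOpen_ball.measurableSet (Metric.measure_ball_pos volume x₀ hr).ne'
    measure_ball_lt_top.ne hub hloc.aestronglyMeasurable
  have hgM : ∫ y, ‖(g y : ℂ)‖ ≤ 2 * volume.real (Metric.ball x₀ r) := by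
    have e : ∫ y, ‖(g y : ℂ)‖ = ∫ y in Metric.ball x₀ r, ‖(g y : ℂ)‖ :=
      (setIntegral_eq_integral_of_forall_compl_eq_zero fun y hy => by simp [hgs y hy]).symm
    have : IsFiniteMeasure (volume.restrict (Metric.ball x₀ r)) :=
      ⟨by simpa using measure_ball_lt_top⟩
    rw [e]
    refine (integral_mono_of_nonneg (ae_of_all _ fun y => norm_nonneg _)
      (integrable_const (2 : ℝ)) (ae_of_all _ fun y => ?_)).trans_eq ?_
    · exact (Complex.norm_real _).trans_le (hg2 y)
    · rw [setIntegral_const, smul_eq_mul, mul_comm]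
  have hmain := abs_integral_mul_le_of_potential_le hu hμ (ρ := max 1 (‖x₀‖ + r)) hgi
    (ae_of_all _ hg2) (le_max_left _ _)
    (fun y hy => hgs y fun hyb => by
      have h1 := norm_sub_norm_le y x₀
      have h2 : ‖y - x₀‖ < r := mem_ball_iff_norm.1 hyb
      have h3 := (le_max_right 1 (‖x₀‖ + r)).trans_lt hy
      linarith) hg0
    (hC x₀ r hr (fun y => (g y : ℂ)) 2 hgi.ofReal
      (ae_of_all _ fun y => by rw [Complex.norm_real]; exact hg2 y)
      (fun y hy => by simp [hgs y hy])
      (by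
        have e : ∫ y, ((g y : ℝ) : ℂ) = ((∫ y, g y : ℝ) : ℂ) := integral_complex_ofReal
        rw [e, hg0, Complex.ofReal_zero]))
    tendsto_const_nhds
  rw [setAverage_eq, smul_eq_mul, hosc, inv_mul_le_iff₀ hVpos]
  refine (le_abs_self _).trans (hmain.trans ?_)
  rw [← hT]
  calc C * (2 * r ^ N + ∫ y, ‖(g y : ℂ)‖) * T
      ≤ C * (2 * r ^ N + 2 * volume.real (Metric.ball x₀ r)) * T := by gcongr
    _ = volume.real (Metric.ball x₀ r) * (C * (2 / V₁ + 2) * T) := by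
        rw [hVr]; field_simp

end RieszBMO

theorem proposition1p5 (N : ℕ) (hN : 2 ≤ N)
    (u : RieszBMO.E N → ℝ)
    (hu : MeasureTheory.Integrable (fun x => u x / (1 + ‖x‖) ^ (N + 1)))
    (μ : MeasureTheory.SignedMeasure (RieszBMO.E N))
    (hμ : RieszBMO.HasFracLaplacian (N : ℝ) u μ) :
    RieszBMO.MemBMO u ∧
      RieszBMO.bmoSeminorm u ≤
        ENNReal.ofReal (1 / (((N : ℝ) - 1) * RieszBMO.gammaConst N ((N : ℝ) - 1))) *
          μ.totalVariation Set.univ := by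
  exact ⟨RieszBMO.memBMO hN hu hμ, RieszBMO.bmoSeminorm_le hN hu hμ⟩
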